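/- Let $\mathcal{M}=(\mathcal{S},\mathcal{A},\mathcal{B},P,r,\gamma)$ be a two-player zero-sum discounted Markov game with finite state space $\mathcal S$, finite nonempty action spaces $\mathcal A$ (max player) and $\mathcal B$ (min player), transition kernel $P(\cdot|s,a,b)\in\Delta(\mathcal S)$, rewards $r(s,a,b)\in[0,1]$ and discount factor $0\le\gamma<1$. Let $0<\tau\le \frac{1}{\max\{1,\log|\mathcal A|+\log|\mathcal B|\}}$. For policies $\mu:\mathcal S\to\Delta(\mathcal A)$, $\nu:\mathcal S\to\Delta(\mathcal B)$ put $$V_\tau^{\mu,\nu}(s)=\mathbb E\Big[\sum_{t\ge 0}\gamma^t\big(r(s_t,a_t,b_t)-\tau\log\mu(a_t|s_t)+\tau\log\nu(b_t|s_t)\big)\,\Big|\,s_0=s\Big],$$ where $a_t\sim\mu(\cdot|s_t)$, $b_t\sim\nu(\cdot|s_t)$ independently and $s_{t+1}\sim P(\cdot|s_t,a_t,b_t)$, and $Q_\tau^{\mu,\nu}(s,a,b)=r(s,a,b)+\gamma\,\mathbb E_{s'\sim P(\cdot|s,a,b)}[V_\tau^{\mu,\nu}(s')]$. A policy pair $\zeta_\tau^\star=(\mu_\tau^\star,\nu_\tau^\star)$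 is a quantal response equilibrium (QRE) if $V_\tau^{\mu,\nu_\tau^\star}(s)\le V_\tau^{\mu_\tau^\star,\nu_\tau^\star}(s)\le V_\tau^{\mu_\tau^\star,\nu}(s)$ for all policies $\mu,\nu$ and all $s\in\mathcal S$; write $Q_\tau^\star=Q_\tau^{\mu_\tau^\star,\nu_\tau^\star}$. Entropy-regularized OMWU with learning rates $\eta>0$ and $\{\alpha_t\}_{t\ge1}$: let $\mu^{(0)},\bar\mu^{(0)},\nu^{(0)},\bar\nu^{(0)}$ be the uniform policies, $Q^{(0)}=0$, $V^{(0)}=\tau(\log|\mathcal A|-\log|\mathcal B|)$, and for $t\ge0$ and all $s,a,b$ \begin{align*} \bar\mu^{(t+1)}(a|s)&\propto\mu^{(t)}(a|s)^{1-\eta\tau}\exp\big(\eta[Q^{(t)}(s)\bar\nu^{(t)}(s)]_a\big),\qquad \bar\nu^{(t+1)}(b|s)\propto\nu^{(t)}(b|s)^{1-\eta\tau}\exp\big(-\eta[Q^{(t)}(s)^\top\bar\mu^{(t)}(s)]_b\big),\\ Q^{(t+1)}(s,a,b)&=r(s,a,b)+\gamma\,\mathbb E_{s'\sim P(\cdot|s,a,b)}[V^{(t)}(s')],\\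 V^{(t+1)}(s)&=(1-\alpha_{t+1})V^{(t)}(s)+\alpha_{t+1}\big[\bar\mu^{(t+1)}(s)^\top Q^{(t+1)}(s)\bar\nu^{(t+1)}(s)+\tau\mathcal H(\bar\mu^{(t+1)}(s))-\tau\mathcal H(\bar\nu^{(t+1)}(s))\big],\\ \mu^{(t+1)}(a|s)&\propto\mu^{(t)}(a|s)^{1-\eta\tau}\exp\big(\eta[Q^{(t+1)}(s)\bar\nu^{(t+1)}(s)]_a\big),\qquad \nu^{(t+1)}(b|s)\propto\nu^{(t)}(b|s)^{1-\eta\tau}\exp\big(-\eta[Q^{(t+1)}(s)^\top\bar\mu^{(t+1)}(s)]_b\big), \end{align*} where $\mathcal H$ is the Shannon entropy. Put $\zeta^{(t)}=(\mu^{(t)},\nu^{(t)})$ and $\bar\zeta^{(t)}=(\bar\mu^{(t)},\bar\nu^{(t)})$. Let $\rho\in\Delta(\mathcal S)$ with $\rho(s)>0$ for all $s$, and let $$\mathcal C_\rho=\sup_{t\ge0}\ \sup_{x^{(l)}\in\mathcal A^{\mathcal S},\,y^{(l)}\in\mathcal B^{\mathcal S},\,1\le l\le t}\Big\|\frac{\rho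 P_{x^{(1)},y^{(1)}}\cdots P_{x^{(t)},y^{(t)}}}{\rho}\Big\|_\infty,\qquad [P_{x,y}]_{s,s'}=P(s'|s,x(s),y(s)),$$ with entrywise division. For policy pairs $\zeta=(\mu,\nu)$, $\zeta'=(\mu',\nu')$ let $\mathsf{KL}_\rho(\zeta\,\|\,\zeta')=\mathbb E_{s\sim\rho}\big[\mathsf{KL}(\mu(s)\,\|\,\mu'(s))+\mathsf{KL}(\nu(s)\,\|\,\nu'(s))\big]$, and let $\|M\|_\infty$ be the largest absolute value of an entry of the matrix $M$. Suppose that $0<\eta\le\frac{(1-\gamma)^3}{32000\,\mathcal C_\rho}$ and $\alpha_i=\eta\tau$ for all $i\ge1$. Then the QRE $\zeta_\tau^\star$ exists and is unique, and for all $t\ge0$ $$\max\Big\{\mathsf{KL}_\rho(\zeta_\tau^\star\,\|\,\zeta^{(t)}),\ \tfrac12\mathsf{KL}_\rho(\zeta_\tau^\star\,\|\,\bar\zeta^{(t)}),\ 3\eta\,\mathbb E_{s\sim\rho}\big[\|Q^{(t)}(s)-Q_\tau^\star(s)\|_\infty\big]\Big\}\le\frac{3000}{(1-\gamma)^2\tau}\Big(1-\frac{(1-\gamma)\eta\tau}{4}\Big)^t.$$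 -/

import Mathlib

open scoped Matrix

/-- A two-player zero-sum discounted Markov game with state space `S` and action spaces `A`
(max player) and `B` (min player). `P s a b s'` is the transition probability `P(s' | s, a, b)`. -/
structure MarkovGame (S A B : Type*) [Fintype S] where
  P : S → A → B → S → ℝ
  P_mem : ∀ s a b, P s a b ∈ stdSimplex ℝ S
  r : S → A → B → ℝ
  r_mem : ∀ s a b, r s a b ∈ Set.Icc (0 : ℝ) 1
  γ : ℝ
  γ_nonneg : 0 ≤ γ
  γ_lt_one : γ < 1

/-- A (stationary, randomized) policy: a probability distribution over actions at every state. -/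
def IsPolicy {S A : Type*} [Fintype A] (μ : S → A → ℝ) : Prop :=
  ∀ s, μ s ∈ stdSimplex ℝ A

/-- Shannon entropy of a probability vector. -/
noncomputable def entropy {A : Type*} [Fintype A] (x : A → ℝ) : ℝ :=
  -∑ a, x a * Real.log (x a)

/-- Kullback-Leibler divergence `KL(x ‖ y)` of probability vectors (only used with `y > 0`). -/
noncomputable def klVec {A : Type*} [Fintype A] (x y : A → ℝ) : ℝ :=
  ∑ a, x a * (Real.log (x a) - Real.log (y a))

/-- The maximum absolute value of the entries of a matrix. -/
noncomputable def maxEntry {A B : Type*} (M : A → B → ℝ) : ℝ :=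
  ⨆ p : A × B, |M p.1 p.2|

/-- The bilinear form `xᵀ M y`. -/
def bilin {A B : Type*} [Fintype A] [Fintype B] (x : A → ℝ) (M : A → B → ℝ) (y : B → ℝ) : ℝ :=
  ∑ a, ∑ b, x a * M a b * y b

/-- The probability vector proportional to `y(a)^(1-ητ) * exp(w(a))`, where `c = 1 - ητ`. -/
noncomputable def multUpdate {A : Type*} [Fintype A] (c : ℝ) (y w : A → ℝ) : A → ℝ :=
  fun a => y a ^ c * Real.exp (w a) / ∑ a', y a' ^ c * Real.exp (w a')

/-- `KL_ρ(ζ ‖ ζ') = E_{s ∼ ρ} [KL(μ(s) ‖ μ'(s)) + KL(ν(s) ‖ ν'(s))]` for `ζ = (μ, ν)`,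
`ζ' = (μ', ν')`. -/
noncomputable def klPolicy {S A B : Type*} [Fintype S] [Fintype A] [Fintype B] (ρ : S → ℝ)
    (ζ ζ' : (S → A → ℝ) × (S → B → ℝ)) : ℝ :=
  ∑ s, ρ s * (klVec (ζ.1 s) (ζ'.1 s) + klVec (ζ.2 s) (ζ'.2 s))

namespace MarkovGame

variable {S A B : Type*} [Fintype S] [Fintype A] [Fintype B]

/-- State transition matrix induced by a policy pair `(μ, ν)`. -/
def transition (G : MarkovGame S A B) (μ : S → A → ℝ) (ν : S → B → ℝ) : Matrix S S ℝ :=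
  Matrix.of fun s s' => ∑ a, ∑ b, μ s a * ν s b * G.P s a b s'

/-- Expected one-step regularized reward at state `s`:
`E [r(s,a,b) - τ log μ(a|s) + τ log ν(b|s)]` for independent `a ∼ μ(s)`, `b ∼ ν(s)`. -/
noncomputable def stepReward (G : MarkovGame S A B) (τ : ℝ) (μ : S → A → ℝ) (ν : S → B → ℝ)
    (s : S) : ℝ :=
  ∑ a, ∑ b, μ s a * ν s b * (G.r s a b - τ * Real.log (μ s a) + τ * Real.log (ν s b))

/-- Entropy-regularized value function: the expected discounted sum of the regularized rewards
along the trajectory started at `s`. The `(s, s')` entry of the `t`-th power of the transition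
matrix is the probability that `s_t = s'` given `s_0 = s`. -/
noncomputable def value [DecidableEq S] (G : MarkovGame S A B) (τ : ℝ) (μ : S → A → ℝ)
    (ν : S → B → ℝ) (s : S) : ℝ :=
  ∑' t : ℕ, G.γ ^ t * ∑ s', (G.transition μ ν ^ t) s s' * G.stepReward τ μ ν s'

/-- One-step look-ahead: `r(s,a,b) + γ E_{s' ∼ P(·|s,a,b)} [V(s')]`. -/
def lookahead (G : MarkovGame S A B) (V : S → ℝ) (s : S) (a : A) (b : B) : ℝ :=
  G.r s a b + G.γ * ∑ s', G.P s a b s' * V s'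

/-- Entropy-regularized `Q`-function of a policy pair. -/
noncomputable def qValue [DecidableEq S] (G : MarkovGame S A B) (τ : ℝ) (μ : S → A → ℝ)
    (ν : S → B → ℝ) : S → A → B → ℝ :=
  G.lookahead (G.value τ μ ν)

/-- Quantal response equilibrium: a policy pair which is a saddle point of the regularized value
function (max over `μ`, min over `ν`) at all states simultaneously. -/
def IsQRE [DecidableEq S] (G : MarkovGame S A B) (τ : ℝ)
    (ζ : (S → A → ℝ) × (S → B → ℝ)) : Prop :=
  IsPolicy ζ.1 ∧ IsPolicy ζ.2 ∧ ∀ s,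
    (∀ μ, IsPolicy μ → G.value τ μ ζ.2 s ≤ G.value τ ζ.1 ζ.2 s) ∧
    (∀ ν, IsPolicy ν → G.value τ ζ.1 ζ.2 s ≤ G.value τ ζ.1 ν s)

/-- State transition matrix induced by a pair of deterministic policies. -/
def detTransition (G : MarkovGame S A B) (x : S → A) (y : S → B) : Matrix S S ℝ :=
  Matrix.of fun s s' => G.P s (x s) (y s) s'

/-- The row vector `ρ P_{x⁽¹⁾,y⁽¹⁾} ⋯ P_{x⁽ᵗ⁾,y⁽ᵗ⁾}` (with `x⁽ˡ⁾ = x (l - 1)`,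
`y⁽ˡ⁾ = y (l - 1)`). -/
def pushDist (G : MarkovGame S A B) (ρ : S → ℝ) (x : ℕ → S → A) (y : ℕ → S → B) :
    ℕ → S → ℝ
  | 0 => ρ
  | t + 1 => pushDist G ρ x y t ᵥ* G.detTransition (x t) (y t)

/-- `c_ρ(t)`: the largest entrywise ratio `ρ P ⋯ P / ρ` (`t` factors) over all sequences of pairs
of deterministic policies. Only the first `t` members of the sequences matter. -/
noncomputable def concentrabilityAt (G : MarkovGame S A B) (ρ : S → ℝ) (t : ℕ) : ℝ :=
  ⨆ p : (ℕ → S → A) × (ℕ → S → B), ⨆ s, |G.pushDist ρ p.1 p.2 t s / ρ s|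

/-- The concentrability coefficient `C_ρ = sup_{t ≥ 0} c_ρ(t)`. -/
noncomputable def concentrability (G : MarkovGame S A B) (ρ : S → ℝ) : ℝ :=
  ⨆ t : ℕ, G.concentrabilityAt ρ t

end MarkovGame

/-- The quantities `μ⁽ᵗ⁾, ν⁽ᵗ⁾, μ̄⁽ᵗ⁾, ν̄⁽ᵗ⁾, Q⁽ᵗ⁾, V⁽ᵗ⁾` maintained by the algorithm. -/
structure OMWUState (S A B : Type*) where
  mu : S → A → ℝ
  nu : S → B → ℝ
  muBar : S → A → ℝ
  nuBar : S → B → ℝ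
  Q : S → A → B → ℝ
  V : S → ℝ

namespace OMWUState

variable {S A B : Type*}

/-- The policy pair `ζ⁽ᵗ⁾`. -/
def zeta (z : OMWUState S A B) : (S → A → ℝ) × (S → B → ℝ) := (z.mu, z.nu)

/-- The policy pair `ζ̄⁽ᵗ⁾`. -/
def zetaBar (z : OMWUState S A B) : (S → A → ℝ) × (S → B → ℝ) := (z.muBar, z.nuBar)

end OMWUState

namespace MarkovGame

variable {S A B : Type*} [Fintype S] [Fintype A] [Fintype B]

/-- Initialization: uniform policies, `Q⁽⁰⁾ = 0`, `V⁽⁰⁾ = τ (log |A| - log |B|)`. -/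
noncomputable def omwuInit (S A B : Type*) [Fintype A] [Fintype B] (τ : ℝ) :
    OMWUState S A B where
  mu := fun _ _ => 1 / (Fintype.card A : ℝ)
  nu := fun _ _ => 1 / (Fintype.card B : ℝ)
  muBar := fun _ _ => 1 / (Fintype.card A : ℝ)
  nuBar := fun _ _ => 1 / (Fintype.card B : ℝ)
  Q := fun _ _ _ => 0
  V := fun _ => τ * (Real.log (Fintype.card A) - Real.log (Fintype.card B))

/-- One iteration, from the quantities with index `t` to those with index `t + 1`; `α` is the
learning rate `α_{t+1}` of the value update. -/
noncomputable def omwuStep (G : MarkovGame S A B) (τ η α : ℝ) (z : OMWUState S A B) :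
    OMWUState S A B :=
  let muBar' : S → A → ℝ := fun s =>
    multUpdate (1 - η * τ) (z.mu s) fun a => η * ∑ b, z.Q s a b * z.nuBar s b
  let nuBar' : S → B → ℝ := fun s =>
    multUpdate (1 - η * τ) (z.nu s) fun b => -η * ∑ a, z.Q s a b * z.muBar s a
  let Q' : S → A → B → ℝ := G.lookahead z.V
  let V' : S → ℝ := fun s =>
    (1 - α) * z.V s + α * (bilin (muBar' s) (Q' s) (nuBar' s)
      + τ * entropy (muBar' s) - τ * entropy (nuBar' s))
  { mu := fun s =>
      multUpdate (1 - η * τ) (z.mu s) fun a => η * ∑ b, Q' s a b * nuBar' s b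
    nu := fun s =>
      multUpdate (1 - η * τ) (z.nu s) fun b => -η * ∑ a, Q' s a b * muBar' s a
    muBar := muBar'
    nuBar := nuBar'
    Q := Q'
    V := V' }

/-- The iterates of entropy-regularized OMWU with regularization `τ`, policy learning rate `η`
and value learning rates `α 1, α 2, …`. -/
noncomputable def omwu (G : MarkovGame S A B) (τ η : ℝ) (α : ℕ → ℝ) : ℕ → OMWUState S A B
  | 0 => omwuInit S A B τ
  | t + 1 => G.omwuStep τ η (α (t + 1)) (omwu G τ η α t)

end MarkovGame

/-! Existence and uniqueness come from reducing a QRE to a saddle point, at every state, of the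
entropy-regularized matrix game with payoff matrix `qValue` (`IsQRE.isRegSaddle`,
`isQRE_of_isRegSaddle`). Each matrix game has a unique saddle point, and its value is nonexpansive
in the matrix, so the resulting Shapley operator is a γ-contraction; its fixed point gives the
equilibrium.

For the rate, write δ = 1 - γ. At a fixed state one iteration is an optimistic mirror-descent step
whose matrix moves from Q to Q'. An exact regret identity (`multUpdate_regret`) makes the KL
distance to equilibrium contract by 1 - ητ, up to two errors: η times the distance of Q' to the
equilibrium matrix, and a drift from replacing Q'ν̄' by Qν̄. The drift is paid for by negative KL
terms between consecutive iterates (`klVec_add_le`).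

The value error obeys a recursion of its own. A single player's regret has no sign, so each signed
value error is paired with τ times the KL distance of one player. Because the value step size equals
ητ, both members of such a pair shrink by 1 - ητ and the regret telescopes
(`valuePotential_omwuStep_le`). The Q error at t + 1 is γ times an average of value errors at t
under the transition of some action pair. Those transitions do not preserve ρ, so value errors are
measured by `reachSup`, the supremum over all distributions reachable from ρ: one more transition
stays inside this class and costs only γ. The concentrability coefficient enters only when KL and
drift errors under reachable distributions are compared with those under ρ, and there the small step
size absorbs it.

A weighted sum of the KL distance, the value potential, the Q error and the KL divergence from ζ to
ζ̄ then contracts by 1 - δητ/4 (`coupled_recursion_le`, `lyapunov_omwuStep_le`). -/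

/-! ### Entropy, KL divergence and multiplicative updates on the simplex -/

section FiniteVectors

variable {A : Type*} [Fintype A]

/-- The `ℓ¹` distance of two vectors. -/
def l1Dist (x y : A → ℝ) : ℝ := ∑ a, |x a - y a|

theorem l1Dist_nonneg (x y : A → ℝ) : 0 ≤ l1Dist x y :=
  Finset.sum_nonneg fun _ _ => abs_nonneg _

theorem l1Dist_triangle (x y z : A → ℝ) : l1Dist x z ≤ l1Dist x y + l1Dist y z := by
  unfold l1Dist
  rw [← Finset.sum_add_distrib]
  exact Finset.sum_le_sum fun a _ => abs_sub_le _ _ _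

theorem eq_of_l1Dist_eq_zero {x y : A → ℝ} (h : l1Dist x y = 0) : x = y := by
  funext a
  have := (Finset.sum_eq_zero_iff_of_nonneg (fun _ _ => abs_nonneg _)).1 h a (Finset.mem_univ a)
  exact sub_eq_zero.1 (abs_eq_zero.1 this)

theorem sum_mul_le_mul_l1Dist {w x y : A → ℝ} {k : ℝ} (hw : ∀ a, |w a| ≤ k) :
    ∑ a, w a * (x a - y a) ≤ k * l1Dist x y := by
  unfold l1Dist
  rw [Finset.mul_sum]
  refine Finset.sum_le_sum fun a _ => (le_abs_self _).trans ?_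
  rw [abs_mul]
  exact mul_le_mul_of_nonneg_right (hw a) (abs_nonneg _)

/-- This is `log u ≤ u - 1` at u = √y / √x. Summed over coordinates, it says that KL dominates the
squared Hellinger distance. -/
theorem hellinger_term_le {x y : ℝ} (hx : 0 ≤ x) (hy : 0 < y) :
    2 * x - 2 * (√x * √y) ≤ x * (Real.log x - Real.log y) := by
  rcases hx.eq_or_lt with rfl | hx
  · simp
  · have h1 : Real.log (√y / √x) ≤ √y / √x - 1 :=
      Real.log_le_sub_one_of_pos (div_pos (Real.sqrt_pos.2 hy) (Real.sqrt_pos.2 hx))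
    rw [Real.log_div (Real.sqrt_pos.2 hy).ne' (Real.sqrt_pos.2 hx).ne', Real.log_sqrt hy.le,
      Real.log_sqrt hx.le] at h1
    have h2 := mul_le_mul_of_nonneg_left h1 hx.le
    have h3 : x * (√y / √x - 1) = √x * √y - x := by
      have hs := Real.sqrt_pos.2 hx
      have h4 : x = √x * √x := (Real.mul_self_sqrt hx.le).symm
      have h5 : x * (√y / √x) = √x * √y := by
        rw [← mul_div_assoc, div_eq_iff hs.ne']
        linear_combination √y * h4
      rw [mul_sub, h5, mul_one]
    rw [h3] at h2
    linarith

/-- A weak form of Pinsker's inequality. -/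
theorem l1Dist_sq_le {x y : A → ℝ} (hx : x ∈ stdSimplex ℝ A) (hy : y ∈ stdSimplex ℝ A)
    (hy0 : ∀ a, 0 < y a) : l1Dist x y ^ 2 ≤ 4 * klVec x y := by
  have h1 : ∑ a, (√(x a) - √(y a)) ^ 2 ≤ klVec x y := by
    have e : ∑ a, (√(x a) - √(y a)) ^ 2 = ∑ a, (2 * x a - 2 * (√(x a) * √(y a))) := by
      have : ∀ a, (√(x a) - √(y a)) ^ 2 = (2 * x a - 2 * (√(x a) * √(y a))) + (y a - x a) := by
        intro a
        have := Real.sq_sqrt (hx.1 a)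
        have := Real.sq_sqrt (hy.1 a)
        nlinarith
      simp_rw [this]
      rw [Finset.sum_add_distrib, Finset.sum_sub_distrib y x, hx.2, hy.2]
      ring
    rw [e]
    exact Finset.sum_le_sum fun a _ => hellinger_term_le (hx.1 a) (hy0 a)
  have h2 : ∑ a, (√(x a) + √(y a)) ^ 2 ≤ 4 := by
    have : ∑ a, (√(x a) + √(y a)) ^ 2 ≤ ∑ a, (2 * x a + 2 * y a) := by
      refine Finset.sum_le_sum fun a _ => ?_
      have := Real.sq_sqrt (hx.1 a)
      have := Real.sq_sqrt (hy.1 a)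
      nlinarith [sq_nonneg (√(x a) - √(y a))]
    rw [Finset.sum_add_distrib, ← Finset.mul_sum, ← Finset.mul_sum, hx.2, hy.2] at this
    linarith
  -- The factorization of a difference of squares sets up Cauchy–Schwarz between `h1` and `h2`.
  have h3 : l1Dist x y = ∑ a, |√(x a) - √(y a)| * (√(x a) + √(y a)) := by
    refine Finset.sum_congr rfl fun a _ => ?_
    have h0 : 0 ≤ √(x a) + √(y a) := by positivity
    conv_rhs => rw [← abs_of_nonneg h0, ← abs_mul]
    congr 1
    have := Real.sq_sqrt (hx.1 a)
    have := Real.sq_sqrt (hy.1 a)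
    nlinarith
  have h4 := Finset.sum_mul_sq_le_sq_mul_sq Finset.univ (fun a => |√(x a) - √(y a)|)
    (fun a => √(x a) + √(y a))
  rw [← h3] at h4
  simp only [sq_abs] at h4
  refine h4.trans ?_
  rw [mul_comm]
  exact mul_le_mul h2 h1 (Finset.sum_nonneg fun a _ => sq_nonneg _) (by norm_num)

theorem klVec_nonneg {x y : A → ℝ} (hx : x ∈ stdSimplex ℝ A) (hy : y ∈ stdSimplex ℝ A)
    (hy0 : ∀ a, 0 < y a) : 0 ≤ klVec x y := by
  have := l1Dist_sq_le hx hy hy0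
  nlinarith [sq_nonneg (l1Dist x y)]

theorem eq_of_klVec_le_zero {x y : A → ℝ} (hx : x ∈ stdSimplex ℝ A) (hy : y ∈ stdSimplex ℝ A)
    (hy0 : ∀ a, 0 < y a) (h : klVec x y ≤ 0) : x = y := by
  apply eq_of_l1Dist_eq_zero
  have := l1Dist_sq_le hx hy hy0
  exact pow_eq_zero_iff (two_ne_zero) |>.1 (le_antisymm (by linarith) (sq_nonneg _))

theorem klVec_self (x : A → ℝ) : klVec x x = 0 := by
  simp [klVec]

theorem klVec_eq (x y : A → ℝ) : klVec x y = -entropy x - ∑ a, x a * Real.log (y a) := by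
  simp only [klVec, entropy, mul_sub, Finset.sum_sub_distrib, neg_neg]

theorem le_one_of_mem_stdSimplex {x : A → ℝ} (hx : x ∈ stdSimplex ℝ A) (a : A) : x a ≤ 1 := by
  rw [← hx.2]
  exact Finset.single_le_sum (fun i _ => hx.1 i) (Finset.mem_univ a)

theorem entropy_nonneg {x : A → ℝ} (hx : x ∈ stdSimplex ℝ A) : 0 ≤ entropy x := by
  unfold entropy
  rw [← Finset.sum_neg_distrib]
  refine Finset.sum_nonneg fun a _ => ?_
  have := mul_nonneg (hx.1 a)
    (neg_nonneg.2 (Real.log_nonpos (hx.1 a) (le_one_of_mem_stdSimplex hx a)))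
  linarith

theorem uniform_mem_stdSimplex [Nonempty A] :
    (fun _ : A => 1 / (Fintype.card A : ℝ)) ∈ stdSimplex ℝ A := by
  refine ⟨fun _ => by positivity, ?_⟩
  simp

theorem klVec_uniform {x : A → ℝ} (hx : x ∈ stdSimplex ℝ A) :
    klVec x (fun _ => 1 / (Fintype.card A : ℝ)) = Real.log (Fintype.card A) - entropy x := by
  rw [klVec_eq, ← Finset.sum_mul, hx.2]
  simp
  ring

theorem entropy_le_log_card [Nonempty A] {x : A → ℝ} (hx : x ∈ stdSimplex ℝ A) :
    entropy x ≤ Real.log (Fintype.card A) := by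
  have := klVec_nonneg hx uniform_mem_stdSimplex (fun _ => by positivity)
  rw [klVec_uniform hx] at this
  linarith

theorem log_card_nonneg (A : Type*) [Fintype A] : 0 ≤ Real.log (Fintype.card A : ℝ) :=
  Real.log_natCast_nonneg _

theorem continuous_entropy : Continuous (entropy : (A → ℝ) → ℝ) := by
  unfold entropy
  refine (continuous_finsetSum _ fun a _ => ?_).neg
  exact Real.continuous_mul_log.comp (continuous_apply a)

theorem entropy_combo_le {x y : A → ℝ} (hx : x ∈ stdSimplex ℝ A) (hy : y ∈ stdSimplex ℝ A)
    {p q : ℝ} (hp : 0 ≤ p) (hq : 0 ≤ q) (hpq : p + q = 1) :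
    p * entropy x + q * entropy y ≤ entropy (fun a => p * x a + q * y a) := by
  unfold entropy
  have : ∑ a, (p * x a + q * y a) * Real.log (p * x a + q * y a)
      ≤ ∑ a, (p * (x a * Real.log (x a)) + q * (y a * Real.log (y a))) :=
    Finset.sum_le_sum fun a _ => by
      simpa using Real.convexOn_mul_log.2 (Set.mem_Ici.2 (hx.1 a)) (Set.mem_Ici.2 (hy.1 a)) hp hq hpq
  rw [Finset.sum_add_distrib, ← Finset.mul_sum, ← Finset.mul_sum] at this
  linarith

/-- The normalizing constant of `multUpdate`. -/
noncomputable def multNorm (c : ℝ) (y w : A → ℝ) : ℝ := ∑ a, y a ^ c * Real.exp (w a)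

section MultUpdate

variable [Nonempty A] {c : ℝ} {y w : A → ℝ}

theorem multNorm_pos (hy : ∀ a, 0 < y a) : 0 < multNorm c y w :=
  Finset.sum_pos (fun a _ => mul_pos (Real.rpow_pos_of_pos (hy a) _) (Real.exp_pos _))
    Finset.univ_nonempty

theorem multUpdate_pos (hy : ∀ a, 0 < y a) (a : A) : 0 < multUpdate c y w a :=
  div_pos (mul_pos (Real.rpow_pos_of_pos (hy a) _) (Real.exp_pos _)) (multNorm_pos hy)

theorem multUpdate_mem (hy : ∀ a, 0 < y a) : multUpdate c y w ∈ stdSimplex ℝ A := by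
  refine ⟨fun a => (multUpdate_pos hy a).le, ?_⟩
  unfold multUpdate
  rw [← Finset.sum_div]
  exact div_self (multNorm_pos (c := c) (w := w) hy).ne'

theorem log_multUpdate (hy : ∀ a, 0 < y a) (a : A) :
    Real.log (multUpdate c y w a) = c * Real.log (y a) + w a - Real.log (multNorm c y w) := by
  have h1 := Real.rpow_pos_of_pos (hy a) c
  have : multUpdate c y w a = y a ^ c * Real.exp (w a) / multNorm c y w := rfl
  rw [this, Real.log_div (mul_pos h1 (Real.exp_pos _)).ne' (multNorm_pos hy).ne',
    Real.log_mul h1.ne' (Real.exp_pos _).ne', Real.log_rpow (hy a), Real.log_exp]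

/-- The logarithm of the update is affine in `log y` and `w`. The normalizer enters as a constant
independent of `x`, so it cancels in differences over `x`. -/
theorem klVec_multUpdate (hy : ∀ a, 0 < y a) {x : A → ℝ} (hx : x ∈ stdSimplex ℝ A) :
    klVec x (multUpdate c y w) = c * klVec x y - (1 - c) * entropy x - ∑ a, x a * w a
      + Real.log (multNorm c y w) := by
  have : ∑ a, x a * Real.log (multUpdate c y w a)
      = c * ∑ a, x a * Real.log (y a) + ∑ a, x a * w a - Real.log (multNorm c y w) := by
    have e : ∀ a, x a * Real.log (multUpdate c y w a) =
        c * (x a * Real.log (y a)) + x a * w a - x a * Real.log (multNorm c y w) := by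
      intro a; rw [log_multUpdate hy]; ring
    simp_rw [e]
    rw [Finset.sum_sub_distrib, Finset.sum_add_distrib, ← Finset.mul_sum, ← Finset.sum_mul, hx.2,
      one_mul]
  rw [klVec_eq, klVec_eq, this]
  ring

/-- The one-step regret identity of the multiplicative update. -/
theorem multUpdate_regret (hy : ∀ a, 0 < y a) {x z : A → ℝ} (hx : x ∈ stdSimplex ℝ A)
    (hz : z ∈ stdSimplex ℝ A) :
    (∑ a, x a * w a + (1 - c) * entropy x) - (∑ a, z a * w a + (1 - c) * entropy z)
      = c * klVec x y - klVec x (multUpdate c y w)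
        + (klVec z (multUpdate c y w) - c * klVec z y) := by
  rw [klVec_multUpdate hy hx, klVec_multUpdate hy hz]
  ring

/-- Comparison of two multiplicative updates started from the same point. -/
theorem klVec_multUpdate_sub (hy : ∀ a, 0 < y a) {v : A → ℝ} {x z : A → ℝ}
    (hx : x ∈ stdSimplex ℝ A) (hz : z ∈ stdSimplex ℝ A) :
    (klVec x (multUpdate c y v) - klVec x (multUpdate c y w))
      - (klVec z (multUpdate c y v) - klVec z (multUpdate c y w))
      = ∑ a, (w a - v a) * (x a - z a) := by
  have : ∑ a, (w a - v a) * (x a - z a) = ∑ a, x a * w a - ∑ a, x a * v a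
      - ∑ a, z a * w a + ∑ a, z a * v a := by
    rw [← Finset.sum_sub_distrib, ← Finset.sum_sub_distrib, ← Finset.sum_add_distrib]
    exact Finset.sum_congr rfl fun a _ => by ring
  rw [klVec_multUpdate hy hx, klVec_multUpdate hy hz, klVec_multUpdate hy hx,
    klVec_multUpdate hy hz, this]
  ring

end MultUpdate

end FiniteVectors

/-! ### Entropy-regularized matrix games and their saddle points -/

section RegularizedMatrixGame

variable {A B : Type*} [Fintype A] [Fintype B]

/-- The payoff `xᵀ M y + τ H(x) - τ H(y)` of an entropy-regularized matrix game. -/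
noncomputable def regPayoff (τ : ℝ) (M : A → B → ℝ) (x : A → ℝ) (y : B → ℝ) : ℝ :=
  bilin x M y + τ * entropy x - τ * entropy y

theorem bilin_eq_sum_left (x : A → ℝ) (M : A → B → ℝ) (y : B → ℝ) :
    bilin x M y = ∑ a, x a * ∑ b, M a b * y b := by
  simp only [bilin, Finset.mul_sum, mul_assoc]

theorem bilin_eq_sum_right (x : A → ℝ) (M : A → B → ℝ) (y : B → ℝ) :
    bilin x M y = ∑ b, y b * ∑ a, M a b * x a := by
  simp only [bilin, Finset.mul_sum]
  rw [Finset.sum_comm]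
  exact Finset.sum_congr rfl fun _ _ => Finset.sum_congr rfl fun _ _ => by ring

theorem bilin_sub_middle (x : A → ℝ) (M N : A → B → ℝ) (y : B → ℝ) :
    bilin x (fun a b => M a b - N a b) y = bilin x M y - bilin x N y := by
  simp only [bilin, mul_sub, sub_mul, Finset.sum_sub_distrib]

theorem abs_sum_mul_le {w y : B → ℝ} {k : ℝ} (hy : y ∈ stdSimplex ℝ B) (hw : ∀ b, |w b| ≤ k) :
    |∑ b, w b * y b| ≤ k := by
  refine (Finset.abs_sum_le_sum_abs _ _).trans ?_
  calc ∑ b, |w b * y b| ≤ ∑ b, k * y b := Finset.sum_le_sum fun b _ => by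
        rw [abs_mul, abs_of_nonneg (hy.1 b)]
        exact mul_le_mul_of_nonneg_right (hw b) (hy.1 b)
    _ = k := by rw [← Finset.mul_sum, hy.2, mul_one]

theorem abs_bilin_le {x : A → ℝ} {M : A → B → ℝ} {y : B → ℝ} {k : ℝ}
    (hx : x ∈ stdSimplex ℝ A) (hy : y ∈ stdSimplex ℝ B) (hM : ∀ a b, |M a b| ≤ k) :
    |bilin x M y| ≤ k := by
  rw [bilin_eq_sum_left]
  simp_rw [mul_comm (x _)]
  exact abs_sum_mul_le hx fun a => abs_sum_mul_le hy (hM a)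

theorem regPayoff_sub_le {τ : ℝ} {x : A → ℝ} {M N : A → B → ℝ} {y : B → ℝ} {k : ℝ}
    (hx : x ∈ stdSimplex ℝ A) (hy : y ∈ stdSimplex ℝ B) (hM : ∀ a b, |M a b - N a b| ≤ k) :
    |regPayoff τ M x y - regPayoff τ N x y| ≤ k := by
  have := abs_bilin_le hx hy hM
  rw [bilin_sub_middle] at this
  unfold regPayoff
  convert this using 2
  ring

theorem abs_regPayoff_le [Nonempty A] [Nonempty B] {τ : ℝ} (hτ : 0 ≤ τ)
    (hτ1 : τ * (Real.log (Fintype.card A) + Real.log (Fintype.card B)) ≤ 1)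
    {x : A → ℝ} {M : A → B → ℝ} {y : B → ℝ} {k : ℝ}
    (hx : x ∈ stdSimplex ℝ A) (hy : y ∈ stdSimplex ℝ B) (hM : ∀ a b, |M a b| ≤ k) :
    |regPayoff τ M x y| ≤ k + 1 := by
  have h1 := abs_le.1 (abs_bilin_le hx hy hM)
  have h2 := mul_nonneg hτ (entropy_nonneg hx)
  have h3 := mul_nonneg hτ (entropy_nonneg hy)
  have h4 := mul_le_mul_of_nonneg_left (entropy_le_log_card hx) hτ
  have h5 := mul_le_mul_of_nonneg_left (entropy_le_log_card hy) hτ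
  have h6 := mul_nonneg hτ (log_card_nonneg A)
  have h7 := mul_nonneg hτ (log_card_nonneg B)
  unfold regPayoff
  rw [mul_add] at hτ1
  rw [abs_le]
  constructor <;> linarith

/-- Exchanging the players is transposition and negation; every bound for the max player thereby
yields one for the min player. -/
theorem regPayoff_swap (τ : ℝ) (M : A → B → ℝ) (x : A → ℝ) (y : B → ℝ) :
    regPayoff τ (fun b a => -M a b) y x = -regPayoff τ M x y := by
  have : bilin y (fun b a => -M a b) x = -bilin x M y := by
    rw [bilin_eq_sum_left, bilin_eq_sum_right]
    simp [Finset.sum_neg_distrib]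
  unfold regPayoff
  rw [this]
  ring

/-- The entropy-regularized best response of the max player to `y`. -/
noncomputable def bestResponse (τ : ℝ) (M : A → B → ℝ) (y : B → ℝ) : A → ℝ :=
  multUpdate 0 1 fun a => (∑ b, M a b * y b) / τ

/-- Saddle points of an entropy-regularized matrix game (max over `x`, min over `y`). -/
def IsRegSaddle (τ : ℝ) (M : A → B → ℝ) (x : A → ℝ) (y : B → ℝ) : Prop :=
  (∀ x' ∈ stdSimplex ℝ A, regPayoff τ M x' y ≤ regPayoff τ M x y) ∧
    ∀ y' ∈ stdSimplex ℝ B, regPayoff τ M x y ≤ regPayoff τ M x y'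

theorem regPayoff_convex_right {τ : ℝ} (hτ : 0 ≤ τ) (M : A → B → ℝ) (x : A → ℝ) {y z : B → ℝ}
    (hy : y ∈ stdSimplex ℝ B) (hz : z ∈ stdSimplex ℝ B) {p q : ℝ} (hp : 0 ≤ p) (hq : 0 ≤ q)
    (hpq : p + q = 1) :
    regPayoff τ M x (fun b => p * y b + q * z b)
      ≤ p * regPayoff τ M x y + q * regPayoff τ M x z := by
  have h1 : bilin x M (fun b => p * y b + q * z b) = p * bilin x M y + q * bilin x M z := by
    simp only [bilin, mul_add, Finset.sum_add_distrib, Finset.mul_sum]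
    congr 1 <;> exact Finset.sum_congr rfl fun _ _ => Finset.sum_congr rfl fun _ _ => by ring
  have h2 := mul_le_mul_of_nonneg_left (entropy_combo_le hy hz hp hq hpq) hτ
  unfold regPayoff
  rw [h1]
  obtain rfl : q = 1 - p := by linarith
  linarith

theorem IsRegSaddle.swap {τ : ℝ} {M : A → B → ℝ} {x : A → ℝ} {y : B → ℝ}
    (h : IsRegSaddle τ M x y) : IsRegSaddle τ (fun b a => -M a b) y x := by
  refine ⟨fun y' hy' => ?_, fun x' hx' => ?_⟩
  · rw [regPayoff_swap, regPayoff_swap]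
    exact neg_le_neg (h.2 y' hy')
  · rw [regPayoff_swap, regPayoff_swap]
    exact neg_le_neg (h.1 x' hx')

theorem regSaddle_value_sub_le {τ : ℝ} {M N : A → B → ℝ} {x x' : A → ℝ} {y y' : B → ℝ} {k : ℝ}
    (hx : x ∈ stdSimplex ℝ A) (hy' : y' ∈ stdSimplex ℝ B)
    (h : IsRegSaddle τ M x y) (h' : IsRegSaddle τ N x' y') (hk : ∀ a b, |M a b - N a b| ≤ k) :
    regPayoff τ M x y - regPayoff τ N x' y' ≤ k := by
  have h1 := h.2 y' hy'
  have h2 := h'.1 x hx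
  have h3 := (abs_le.1 (regPayoff_sub_le (τ := τ) hx hy' hk)).2
  linarith

theorem Continuous.regPayoff {X : Type*} [TopologicalSpace X] (τ : ℝ) (M : A → B → ℝ)
    {f : X → A → ℝ} {g : X → B → ℝ} (hf : Continuous f) (hg : Continuous g) :
    Continuous fun t => regPayoff τ M (f t) (g t) := by
  have h1 : Continuous fun t => entropy (f t) := continuous_entropy.comp hf
  have h2 : Continuous fun t => entropy (g t) := continuous_entropy.comp hg
  have h3 : Continuous fun t => bilin (f t) M (g t) := by
    unfold bilin
    fun_prop
  exact (h3.add (h1.const_mul τ)).sub (h2.const_mul τ)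

variable [Nonempty A]

theorem bestResponse_pos (τ : ℝ) (M : A → B → ℝ) (y : B → ℝ) (a : A) :
    0 < bestResponse τ M y a :=
  multUpdate_pos (fun _ => one_pos) a

theorem bestResponse_mem (τ : ℝ) (M : A → B → ℝ) (y : B → ℝ) :
    bestResponse τ M y ∈ stdSimplex ℝ A :=
  multUpdate_mem fun _ => one_pos

/-- Gibbs variational principle: the regret identity with c = 0 started at the all-ones vector,
where the terms involving that vector vanish. -/
theorem regPayoff_eq_sub_klVec {τ : ℝ} (hτ : τ ≠ 0) (M : A → B → ℝ) {x : A → ℝ}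
    (hx : x ∈ stdSimplex ℝ A) (y : B → ℝ) :
    regPayoff τ M x y
      = regPayoff τ M (bestResponse τ M y) y - τ * klVec x (bestResponse τ M y) := by
  have h := multUpdate_regret (c := 0) (y := (1 : A → ℝ))
    (w := fun a => (∑ b, M a b * y b) / τ) (fun _ => one_pos) hx (bestResponse_mem τ M y)
  have e : ∀ z : A → ℝ, ∑ a, z a * ((∑ b, M a b * y b) / τ) = bilin z M y / τ := by
    intro z
    rw [bilin_eq_sum_left, Finset.sum_div]
    exact Finset.sum_congr rfl fun a _ => by ring
  change _ = 0 * klVec x 1 - klVec x (bestResponse τ M y)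
    + (klVec (bestResponse τ M y) (bestResponse τ M y) - 0 * klVec (bestResponse τ M y) 1) at h
  rw [klVec_self, e, e] at h
  unfold regPayoff
  field_simp at h
  linarith

theorem continuous_bestResponse (τ : ℝ) (M : A → B → ℝ) : Continuous (bestResponse τ M) := by
  refine continuous_pi fun a => ?_
  unfold bestResponse multUpdate
  refine Continuous.div ?_ ?_ fun y => (multNorm_pos (fun _ => one_pos)).ne'
  · fun_prop
  · fun_prop

/-- Danskin-type argument: take y minimizing the best-response value, and move it slightly towards
z. Minimality and convexity in y bound the value from above by the payoff at z of the best response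
to the perturbed point; continuity of the best response lets the perturbation tend to 0. -/
theorem exists_isRegSaddle [Nonempty B] {τ : ℝ} (hτ : 0 < τ) (M : A → B → ℝ) :
    ∃ x ∈ stdSimplex ℝ A, ∃ y ∈ stdSimplex ℝ B, IsRegSaddle τ M x y := by
  have hg : Continuous fun y => regPayoff τ M (bestResponse τ M y) y :=
    (continuous_bestResponse τ M).regPayoff τ M continuous_id
  obtain ⟨y, hy, hmin⟩ := (isCompact_stdSimplex ℝ B).exists_isMinOn
    ⟨_, uniform_mem_stdSimplex⟩ hg.continuousOn
  have hbr : ∀ z : B → ℝ, ∀ x' ∈ stdSimplex ℝ A,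
      regPayoff τ M x' z ≤ regPayoff τ M (bestResponse τ M z) z := by
    intro z x' hx'
    rw [regPayoff_eq_sub_klVec hτ.ne' M hx' z]
    have := klVec_nonneg hx' (bestResponse_mem τ M z) (bestResponse_pos τ M z)
    nlinarith
  refine ⟨bestResponse τ M y, bestResponse_mem τ M y, y, hy, hbr y, fun z hz => ?_⟩
  set ψ : ℝ → B → ℝ := fun ε b => (1 - ε) * y b + ε * z b with hψ
  have hψc : Continuous ψ := by fun_prop
  have hφ : Continuous fun ε => regPayoff τ M (bestResponse τ M (ψ ε)) z :=
    ((continuous_bestResponse τ M).comp hψc).regPayoff τ M continuous_const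
  have hlim := (hφ.tendsto 0).mono_left (nhdsWithin_le_nhds (s := Set.Ioi 0))
  have hψ0 : ψ 0 = y := by funext b; simp [hψ]
  rw [hψ0] at hlim
  refine ge_of_tendsto hlim ?_
  filter_upwards [Ioo_mem_nhdsGT (zero_lt_one' ℝ)] with ε hε
  have hmem : ψ ε ∈ stdSimplex ℝ B :=
    convex_stdSimplex ℝ B hy hz (by linarith [hε.2]) hε.1.le (by ring)
  have h1 : regPayoff τ M (bestResponse τ M y) y
      ≤ regPayoff τ M (bestResponse τ M (ψ ε)) (ψ ε) := hmin hmem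
  have h2 := regPayoff_convex_right hτ.le M (bestResponse τ M (ψ ε)) hy hz
    (by linarith [hε.2] : 0 ≤ 1 - ε) hε.1.le (by ring)
  have h3 := hbr y _ (bestResponse_mem τ M (ψ ε))
  have h4 := mul_le_mul_of_nonneg_left h3 (by linarith [hε.2] : 0 ≤ 1 - ε)
  have h5 : ε * regPayoff τ M (bestResponse τ M y) y
      ≤ ε * regPayoff τ M (bestResponse τ M (ψ ε)) z := by
    change _ ≤ regPayoff τ M _ (ψ ε) at h1
    change regPayoff τ M _ (ψ ε) ≤ _ at h2
    linarith
  exact le_of_mul_le_mul_left h5 hε.1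

theorem eq_bestResponse_of_forall_le {τ : ℝ} (hτ : 0 < τ) {M : A → B → ℝ} {x : A → ℝ} {y : B → ℝ}
    (hx : x ∈ stdSimplex ℝ A)
    (h : ∀ x' ∈ stdSimplex ℝ A, regPayoff τ M x' y ≤ regPayoff τ M x y) :
    x = bestResponse τ M y := by
  refine eq_of_klVec_le_zero hx (bestResponse_mem τ M y) (bestResponse_pos τ M y) ?_
  have h1 := h _ (bestResponse_mem τ M y)
  rw [regPayoff_eq_sub_klVec hτ.ne' M hx y] at h1
  nlinarith

/-- Saddle points are interchangeable, so both `x₁` and `x₂` are best responses to `y₁`, and the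
best response is unique. -/
theorem IsRegSaddle.unique_left {τ : ℝ} (hτ : 0 < τ) {M : A → B → ℝ} {x₁ x₂ : A → ℝ}
    {y₁ y₂ : B → ℝ} (hx₁ : x₁ ∈ stdSimplex ℝ A) (hx₂ : x₂ ∈ stdSimplex ℝ A)
    (hy₁ : y₁ ∈ stdSimplex ℝ B) (hy₂ : y₂ ∈ stdSimplex ℝ B)
    (h₁ : IsRegSaddle τ M x₁ y₁) (h₂ : IsRegSaddle τ M x₂ y₂) : x₁ = x₂ := by
  rw [eq_bestResponse_of_forall_le hτ hx₁ h₁.1]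
  refine (eq_bestResponse_of_forall_le hτ hx₂ fun x' hx' => ?_).symm
  exact (h₁.1 x' hx').trans ((h₁.2 y₂ hy₂).trans ((h₂.1 x₁ hx₁).trans (h₂.2 y₁ hy₁)))

end RegularizedMatrixGame

/-! ### Bellman equation and comparison principle for a policy pair -/

namespace MarkovGame

section Value

variable {S A B : Type*} [Fintype S]

theorem lookahead_sub (G : MarkovGame S A B) (V W : S → ℝ) (s : S) (a : A) (b : B) :
    G.lookahead V s a b - G.lookahead W s a b = G.γ * ∑ s', G.P s a b s' * (V s' - W s') := by
  simp only [lookahead, mul_sub, Finset.sum_sub_distrib]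
  ring

theorem lookahead_sub_le (G : MarkovGame S A B) {V W : S → ℝ} {k : ℝ}
    (h : ∀ s, V s - W s ≤ k) (s : S) (a : A) (b : B) :
    G.lookahead V s a b - G.lookahead W s a b ≤ G.γ * k := by
  rw [lookahead_sub]
  refine mul_le_mul_of_nonneg_left ?_ G.γ_nonneg
  calc ∑ s', G.P s a b s' * (V s' - W s') ≤ ∑ s', G.P s a b s' * k :=
        Finset.sum_le_sum fun s' _ => mul_le_mul_of_nonneg_left (h s') ((G.P_mem s a b).1 s')
    _ = k := by rw [← Finset.sum_mul, (G.P_mem s a b).2, one_mul]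

theorem abs_lookahead_sub_le (G : MarkovGame S A B) {V W : S → ℝ} {k : ℝ}
    (h : ∀ s, |V s - W s| ≤ k) (s : S) (a : A) (b : B) :
    |G.lookahead V s a b - G.lookahead W s a b| ≤ G.γ * k := by
  have h1 := G.lookahead_sub_le (fun s => (abs_le.1 (h s)).2) s a b
  have h2 := G.lookahead_sub_le (V := W) (W := V) (k := k)
    (fun s => by linarith [(abs_le.1 (h s)).1]) s a b
  rw [abs_le]
  constructor <;> linarith

theorem abs_lookahead_le (G : MarkovGame S A B) {V : S → ℝ} {k : ℝ} (h : ∀ s, |V s| ≤ k)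
    (s : S) (a : A) (b : B) : |G.lookahead V s a b| ≤ 1 + G.γ * k := by
  have h1 := abs_le.1 (G.abs_lookahead_sub_le (V := V) (W := fun _ => 0) (k := k)
    (fun s => by simpa using h s) s a b)
  have h2 : G.lookahead (fun _ => 0) s a b = G.r s a b := by simp [lookahead]
  have h3 := G.r_mem s a b
  rw [h2] at h1
  rw [abs_le]
  constructor <;> linarith [h3.1, h3.2]

variable [Fintype A] [Fintype B]

/-- The regularized Bellman operator of a policy pair. -/
noncomputable def bellman (G : MarkovGame S A B) (τ : ℝ) (μ : S → A → ℝ) (ν : S → B → ℝ)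
    (V : S → ℝ) (s : S) : ℝ :=
  regPayoff τ (G.lookahead V s) (μ s) (ν s)

variable {G : MarkovGame S A B} {τ : ℝ} {μ : S → A → ℝ} {ν : S → B → ℝ}

theorem bilin_lookahead (G : MarkovGame S A B) (μ : S → A → ℝ) (ν : S → B → ℝ) (V : S → ℝ)
    (s : S) : bilin (μ s) (G.lookahead V s) (ν s)
      = bilin (μ s) (G.r s) (ν s) + G.γ * ∑ s', G.transition μ ν s s' * V s' := by
  have h : ∑ s', G.transition μ ν s s' * V s'
      = ∑ a, ∑ b, μ s a * (∑ s', G.P s a b s' * V s') * ν s b := by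
    simp only [transition, Matrix.of_apply, Finset.sum_mul, Finset.mul_sum]
    rw [Finset.sum_comm]
    refine Finset.sum_congr rfl fun a _ => ?_
    rw [Finset.sum_comm]
    exact Finset.sum_congr rfl fun b _ => Finset.sum_congr rfl fun s' _ => by ring
  rw [h]
  simp only [bilin, lookahead, Finset.mul_sum, ← Finset.sum_add_distrib]
  refine Finset.sum_congr rfl fun a _ => Finset.sum_congr rfl fun b _ => ?_
  rw [mul_add, add_mul, ← Finset.mul_sum]
  simp only [Finset.mul_sum, Finset.sum_mul]
  congr 1
  exact Finset.sum_congr rfl fun s' _ => by ring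

theorem stepReward_eq (hμ : IsPolicy μ) (hν : IsPolicy ν) (s : S) :
    G.stepReward τ μ ν s = regPayoff τ (G.r s) (μ s) (ν s) := by
  have h1 : ∑ a, ∑ b, μ s a * ν s b * Real.log (μ s a) = -entropy (μ s) := by
    unfold entropy
    rw [neg_neg]
    refine Finset.sum_congr rfl fun a _ => ?_
    rw [← Finset.sum_mul, ← Finset.mul_sum, (hν s).2, mul_one]
  have h2 : ∑ a, ∑ b, μ s a * ν s b * Real.log (ν s b) = -entropy (ν s) := by
    unfold entropy
    rw [neg_neg, Finset.sum_comm]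
    refine Finset.sum_congr rfl fun b _ => ?_
    rw [← Finset.sum_mul, ← Finset.sum_mul, (hμ s).2, one_mul]
  have h3 : G.stepReward τ μ ν s = bilin (μ s) (G.r s) (ν s)
      - τ * ∑ a, ∑ b, μ s a * ν s b * Real.log (μ s a)
      + τ * ∑ a, ∑ b, μ s a * ν s b * Real.log (ν s b) := by
    simp only [stepReward, bilin, Finset.mul_sum, ← Finset.sum_sub_distrib,
      ← Finset.sum_add_distrib]
    exact Finset.sum_congr rfl fun a _ => Finset.sum_congr rfl fun b _ => by ring
  rw [h3, h1, h2, regPayoff]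
  ring

theorem bellman_eq (hμ : IsPolicy μ) (hν : IsPolicy ν) (V : S → ℝ) (s : S) :
    G.bellman τ μ ν V s
      = G.stepReward τ μ ν s + G.γ * ∑ s', G.transition μ ν s s' * V s' := by
  rw [stepReward_eq hμ hν, bellman, regPayoff, bilin_lookahead, regPayoff]
  ring

theorem bellman_sub_le (hμ : IsPolicy μ) (hν : IsPolicy ν) {V W : S → ℝ} {k : ℝ}
    (h : ∀ s, V s - W s ≤ k) (s : S) :
    G.bellman τ μ ν V s - G.bellman τ μ ν W s ≤ G.γ * k := by
  have h1 : bilin (μ s) (fun a b => G.lookahead V s a b - G.lookahead W s a b) (ν s)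
      ≤ G.γ * k := by
    have : bilin (μ s) (fun a b => G.lookahead V s a b - G.lookahead W s a b) (ν s)
        ≤ bilin (μ s) (fun _ _ => G.γ * k) (ν s) :=
      Finset.sum_le_sum fun a _ => Finset.sum_le_sum fun b _ =>
        mul_le_mul_of_nonneg_right (mul_le_mul_of_nonneg_left
          (G.lookahead_sub_le h s a b) ((hμ s).1 a)) ((hν s).1 b)
    refine this.trans_eq ?_
    rw [bilin_eq_sum_left]
    simp only [← Finset.mul_sum, ← Finset.sum_mul, (hμ s).2, (hν s).2]
    ring
  rw [bilin_sub_middle] at h1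
  unfold bellman regPayoff
  linarith

/-- Maximum principle: apply the hypothesis with k the maximum of `D`, at a state where it is
attained. -/
theorem nonpos_of_forall_le_mul {γ : ℝ} (hγ : γ < 1) {D : S → ℝ}
    (h : ∀ k, (∀ s, D s ≤ k) → ∀ s, D s ≤ γ * k) (s : S) : D s ≤ 0 := by
  have : Nonempty S := ⟨s⟩
  obtain ⟨s₀, hs₀⟩ := Finite.exists_max D
  have h1 := h _ hs₀ s₀
  have h2 : D s₀ ≤ 0 := by nlinarith
  exact (hs₀ s).trans h2

variable [DecidableEq S]

theorem transition_mem_rowStochastic (hμ : IsPolicy μ) (hν : IsPolicy ν) :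
    G.transition μ ν ∈ Matrix.rowStochastic ℝ S := by
  rw [Matrix.mem_rowStochastic_iff_sum]
  constructor
  · intro s s'
    exact Finset.sum_nonneg fun a _ => Finset.sum_nonneg fun b _ =>
      mul_nonneg (mul_nonneg ((hμ s).1 a) ((hν s).1 b)) ((G.P_mem s a b).1 s')
  · intro s
    simp only [transition, Matrix.of_apply]
    rw [Finset.sum_comm]
    simp_rw [Finset.sum_comm (s := (Finset.univ : Finset S)), ← Finset.mul_sum,
      (G.P_mem s _ _).2, mul_one, ← Finset.mul_sum, (hν s).2, mul_one, (hμ s).2]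

theorem summable_value (hμ : IsPolicy μ) (hν : IsPolicy ν) (R : S → ℝ) (s : S) :
    Summable fun t : ℕ => G.γ ^ t * ∑ s', (G.transition μ ν ^ t) s s' * R s' := by
  obtain ⟨k, hk⟩ : ∃ k, ∀ s, |R s| ≤ k :=
    ⟨∑ s, |R s|, fun s => Finset.single_le_sum (f := fun s => |R s|)
      (fun _ _ => abs_nonneg _) (Finset.mem_univ s)⟩
  refine Summable.of_norm_bounded
    ((summable_geometric_of_lt_one G.γ_nonneg G.γ_lt_one).mul_right k) fun t => ?_
  have hp := Matrix.mem_rowStochastic_iff_sum.1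
    (pow_mem (transition_mem_rowStochastic (G := G) hμ hν) t)
  rw [Real.norm_eq_abs, abs_mul, abs_of_nonneg (pow_nonneg G.γ_nonneg t)]
  refine mul_le_mul_of_nonneg_left ?_ (pow_nonneg G.γ_nonneg t)
  simp_rw [mul_comm _ (R _)]
  exact abs_sum_mul_le ⟨hp.1 s, hp.2 s⟩ hk

theorem value_eq_bellman (hμ : IsPolicy μ) (hν : IsPolicy ν) (s : S) :
    G.value τ μ ν s = G.bellman τ μ ν (G.value τ μ ν) s := by
  rw [bellman_eq hμ hν]
  set R := G.stepReward τ μ ν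
  have hs := fun s => summable_value (G := G) hμ hν R s
  have h1 : G.value τ μ ν s = ∑' t : ℕ, G.γ ^ t * ∑ s', (G.transition μ ν ^ t) s s' * R s' := rfl
  rw [h1, (hs s).tsum_eq_zero_add]
  congr 1
  · simp [Matrix.one_apply]
  · have h2 : ∀ s', G.transition μ ν s s' * G.value τ μ ν s'
        = ∑' t : ℕ, G.transition μ ν s s'
          * (G.γ ^ t * ∑ s'', (G.transition μ ν ^ t) s' s'' * R s'') := fun s' =>
      (tsum_mul_left).symm
    simp_rw [h2]
    rw [← Summable.tsum_finsetSum fun s' _ => (hs s').mul_left _, ← tsum_mul_left]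
    refine tsum_congr fun t => ?_
    rw [pow_succ' (G.transition μ ν)]
    simp only [Matrix.mul_apply, Finset.mul_sum, Finset.sum_mul]
    rw [Finset.sum_comm]
    exact Finset.sum_congr rfl fun _ _ => Finset.sum_congr rfl fun _ _ => by ring

/-- Comparison principle: a subsolution of the Bellman equation lies below the solution. Together
with its mirror image below it replaces all further work with the series defining the value. -/
theorem le_value_of_le_bellman (hμ : IsPolicy μ) (hν : IsPolicy ν) {V : S → ℝ}
    (h : ∀ s, V s ≤ G.bellman τ μ ν V s) (s : S) : V s ≤ G.value τ μ ν s := by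
  refine sub_nonpos.1 (nonpos_of_forall_le_mul G.γ_lt_one
    (D := fun s => V s - G.value τ μ ν s) (fun k hk s => ?_) s)
  have h1 := bellman_sub_le (G := G) (τ := τ) hμ hν hk s
  rw [← value_eq_bellman hμ hν] at h1
  linarith [h s]

theorem value_le_of_bellman_le (hμ : IsPolicy μ) (hν : IsPolicy ν) {V : S → ℝ}
    (h : ∀ s, G.bellman τ μ ν V s ≤ V s) (s : S) : G.value τ μ ν s ≤ V s := by
  refine sub_nonpos.1 (nonpos_of_forall_le_mul G.γ_lt_one
    (D := fun s => G.value τ μ ν s - V s) (fun k hk s => ?_) s)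
  have h1 := bellman_sub_le (G := G) (τ := τ) hμ hν hk s
  rw [← value_eq_bellman hμ hν] at h1
  linarith [h s]

/-- The number 2 / (1 - γ) solves c = 1 + γc + 1, one unit for the reward and one for the entropy
bonus, so the constants ±c are a super- and a subsolution. -/
theorem abs_value_le [Nonempty A] [Nonempty B] (hτ : 0 ≤ τ)
    (hτ1 : τ * (Real.log (Fintype.card A) + Real.log (Fintype.card B)) ≤ 1)
    (hμ : IsPolicy μ) (hν : IsPolicy ν) (s : S) : |G.value τ μ ν s| ≤ 2 / (1 - G.γ) := by
  have hγ : 0 < 1 - G.γ := sub_pos.2 G.γ_lt_one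
  have hfix : 1 + G.γ * (2 / (1 - G.γ)) + 1 = 2 / (1 - G.γ) := by
    field_simp
    ring
  have key : ∀ c, |c| ≤ 2 / (1 - G.γ) → ∀ s,
      |G.bellman τ μ ν (fun _ => c) s| ≤ 2 / (1 - G.γ) := fun c hc s => by
    rw [← hfix]
    exact abs_regPayoff_le hτ hτ1 (hμ s) (hν s) (G.abs_lookahead_le (fun _ => hc) s)
  have hpos : 0 ≤ 2 / (1 - G.γ) := by positivity
  rw [abs_le]
  constructor
  · exact le_value_of_le_bellman hμ hν (V := fun _ => -(2 / (1 - G.γ)))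
      (fun s => (abs_le.1 (key _ (by rw [abs_neg, abs_of_nonneg hpos]) s)).1) s
  · exact value_le_of_bellman_le hμ hν (V := fun _ => 2 / (1 - G.γ))
      (fun s => (abs_le.1 (key _ (by rw [abs_of_nonneg hpos]) s)).2) s

end Value

/-! ### Quantal response equilibria as statewise saddle points -/

section QRE

variable {S A B : Type*} [Fintype S] [DecidableEq S] [Fintype A] [Fintype B]
  {G : MarkovGame S A B} {τ : ℝ}

/-- A profitable deviation at one state makes the equilibrium value a subsolution for the modified
policy. Optimality forces the new value to equal the old one, contradicting strictness in the
Bellman equation at that state. The min player is symmetric. -/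
theorem IsQRE.isRegSaddle {ζ : (S → A → ℝ) × (S → B → ℝ)} (h : G.IsQRE τ ζ) (s : S) :
    IsRegSaddle τ (G.qValue τ ζ.1 ζ.2 s) (ζ.1 s) (ζ.2 s) := by
  obtain ⟨hμ, hν, hsad⟩ := h
  have hV := fun s => value_eq_bellman (G := G) (τ := τ) hμ hν s
  set V := G.value τ ζ.1 ζ.2
  constructor
  · intro x hx
    by_contra! hlt
    have hμ' : IsPolicy (Function.update ζ.1 s x) := fun s' => by
      by_cases hs : s' = s
      · subst hs; simpa using hx
      · simpa [hs] using hμ s'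
    have hs1 : V s < G.bellman τ (Function.update ζ.1 s x) ζ.2 V s := by
      rw [hV s]
      simp only [bellman, Function.update_self]
      exact hlt
    have h1 : ∀ s', V s' ≤ G.bellman τ (Function.update ζ.1 s x) ζ.2 V s' := fun s' => by
      by_cases hs : s' = s
      · subst hs; exact hs1.le
      · conv_lhs => rw [hV s']
        simp [bellman, hs]
    have h2 : G.value τ (Function.update ζ.1 s x) ζ.2 = V := funext fun s' =>
      le_antisymm ((hsad s').1 _ hμ') (le_value_of_le_bellman hμ' hν h1 s')
    have h3 := value_eq_bellman (G := G) (τ := τ) hμ' hν s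
    rw [h2] at h3
    exact hs1.ne h3
  · intro y hy
    by_contra! hlt
    have hν' : IsPolicy (Function.update ζ.2 s y) := fun s' => by
      by_cases hs : s' = s
      · subst hs; simpa using hy
      · simpa [hs] using hν s'
    have hs1 : G.bellman τ ζ.1 (Function.update ζ.2 s y) V s < V s := by
      rw [hV s]
      simp only [bellman, Function.update_self]
      exact hlt
    have h1 : ∀ s', G.bellman τ ζ.1 (Function.update ζ.2 s y) V s' ≤ V s' := fun s' => by
      by_cases hs : s' = s
      · subst hs; exact hs1.le
      · conv_rhs => rw [hV s']
        simp [bellman, hs]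
    have h2 : G.value τ ζ.1 (Function.update ζ.2 s y) = V := funext fun s' =>
      le_antisymm (value_le_of_bellman_le hμ hν' h1 s') ((hsad s').2 _ hν')
    have h3 := value_eq_bellman (G := G) (τ := τ) hμ hν' s
    rw [h2] at h3
    exact hs1.ne h3.symm

theorem isQRE_of_isRegSaddle {ζ : (S → A → ℝ) × (S → B → ℝ)} (hμ : IsPolicy ζ.1)
    (hν : IsPolicy ζ.2) (h : ∀ s, IsRegSaddle τ (G.qValue τ ζ.1 ζ.2 s) (ζ.1 s) (ζ.2 s)) :
    G.IsQRE τ ζ := by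
  refine ⟨hμ, hν, fun s => ⟨fun μ hμ' => ?_, fun ν hν' => ?_⟩⟩
  · refine value_le_of_bellman_le hμ' hν (fun s => ?_) s
    rw [value_eq_bellman hμ hν]
    exact (h s).1 _ (hμ' s)
  · refine le_value_of_le_bellman hμ hν' (fun s => ?_) s
    rw [value_eq_bellman hμ hν]
    exact (h s).2 _ (hν' s)

/-- Compare both sides with the mixed pair `(ζ.1, ζ'.2)`. -/
theorem IsQRE.value_le {ζ ζ' : (S → A → ℝ) × (S → B → ℝ)} (h : G.IsQRE τ ζ)
    (h' : G.IsQRE τ ζ') (s : S) : G.value τ ζ.1 ζ.2 s ≤ G.value τ ζ'.1 ζ'.2 s := by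
  exact ((h.2.2 s).2 _ h'.2.1).trans ((h'.2.2 s).1 _ h.1)

variable [Nonempty A] [Nonempty B]

/-- Banach's fixed point theorem for the Shapley operator, which sends V to the statewise saddle
values of `lookahead V`. -/
theorem exists_isQRE (hτ : 0 < τ) : ∃ ζ, G.IsQRE τ ζ := by
  choose x hx y hy hxy using fun M : A → B → ℝ => exists_isRegSaddle hτ M
  set T : (S → ℝ) → S → ℝ := fun V s =>
    regPayoff τ (G.lookahead V s) (x (G.lookahead V s)) (y (G.lookahead V s)) with hT
  have hLip : LipschitzWith G.γ.toNNReal T := by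
    refine LipschitzWith.of_dist_le_mul fun V W => ?_
    have hd : ∀ s, |V s - W s| ≤ dist V W := fun s => by
      rw [← Real.dist_eq]
      exact dist_le_pi_dist V W s
    have hd' : ∀ s, |W s - V s| ≤ dist V W := fun s => by
      rw [abs_sub_comm]
      exact hd s
    rw [Real.coe_toNNReal _ G.γ_nonneg, dist_pi_le_iff (mul_nonneg G.γ_nonneg dist_nonneg)]
    intro s
    rw [Real.dist_eq, abs_le]
    have h1 := regSaddle_value_sub_le (hx _) (hy _) (hxy (G.lookahead V s))
      (hxy (G.lookahead W s)) (G.abs_lookahead_sub_le hd s)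
    have h2 := regSaddle_value_sub_le (hx _) (hy _) (hxy (G.lookahead W s))
      (hxy (G.lookahead V s)) (G.abs_lookahead_sub_le hd' s)
    constructor
    · change -(G.γ * dist V W) ≤ _
      simp only [hT]
      linarith
    · exact h1
  have hC : ContractingWith G.γ.toNNReal T :=
    ⟨by simpa using G.γ_lt_one, hLip⟩
  set V := hC.fixedPoint
  have hV : T V = V := hC.fixedPoint_isFixedPt
  have hμ : IsPolicy fun s => x (G.lookahead V s) := fun s => hx _
  have hν : IsPolicy fun s => y (G.lookahead V s) := fun s => hy _
  have hval : G.value τ (fun s => x (G.lookahead V s)) (fun s => y (G.lookahead V s)) = V :=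
    funext fun s => le_antisymm
      (value_le_of_bellman_le hμ hν (fun s => (congrFun hV s).le) s)
      (le_value_of_le_bellman hμ hν (fun s => (congrFun hV s).ge) s)
  refine ⟨(fun s => x (G.lookahead V s), fun s => y (G.lookahead V s)),
    isQRE_of_isRegSaddle hμ hν fun s => ?_⟩
  simp only [qValue, hval]
  exact hxy _

theorem IsQRE.unique (hτ : 0 < τ) {ζ ζ' : (S → A → ℝ) × (S → B → ℝ)} (h : G.IsQRE τ ζ)
    (h' : G.IsQRE τ ζ') : ζ = ζ' := by
  have hV : G.value τ ζ.1 ζ.2 = G.value τ ζ'.1 ζ'.2 :=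
    funext fun s => le_antisymm (h.value_le h' s) (h'.value_le h s)
  have hQ : G.qValue τ ζ.1 ζ.2 = G.qValue τ ζ'.1 ζ'.2 := by
    simp only [qValue, hV]
  have h1 := fun s => h.isRegSaddle s
  rw [hQ] at h1
  refine Prod.ext (funext fun s => ?_) (funext fun s => ?_)
  · exact IsRegSaddle.unique_left hτ (h.1 s) (h'.1 s) (h.2.1 s) (h'.2.1 s) (h1 s)
      (h'.isRegSaddle s)
  · exact IsRegSaddle.unique_left hτ (h.2.1 s) (h'.2.1 s) (h.1 s) (h'.1 s) (h1 s).swap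
      (h'.isRegSaddle s).swap

end QRE

end MarkovGame

/-! ### The largest entry of a matrix -/

section MaxEntry

variable {A B : Type*}

theorem maxEntry_nonneg (M : A → B → ℝ) : 0 ≤ maxEntry M :=
  Real.iSup_nonneg fun _ => abs_nonneg _

variable [Finite A] [Finite B]

theorem abs_le_maxEntry (M : A → B → ℝ) (a : A) (b : B) : |M a b| ≤ maxEntry M :=
  le_ciSup (f := fun p : A × B => |M p.1 p.2|) (Set.finite_range _).bddAbove (a, b)

theorem exists_maxEntry_eq [Nonempty A] [Nonempty B] (M : A → B → ℝ) :
    ∃ a b, maxEntry M = |M a b| := by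
  obtain ⟨p, hp⟩ := exists_eq_ciSup_of_finite (f := fun p : A × B => |M p.1 p.2|)
  exact ⟨p.1, p.2, hp.symm⟩

end MaxEntry

/-! ### Reachable distributions and concentrability -/

namespace MarkovGame

section Concentrability

variable {S A B : Type*} [Fintype S] (G : MarkovGame S A B) {ρ : S → ℝ}

theorem pushDist_mem (hρ : ρ ∈ stdSimplex ℝ S) (x : ℕ → S → A) (y : ℕ → S → B) (t : ℕ) :
    G.pushDist ρ x y t ∈ stdSimplex ℝ S := by
  induction t with
  | zero => exact hρ
  | succ t ih =>
    constructor
    · intro s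
      exact Finset.sum_nonneg fun s' _ => mul_nonneg (ih.1 s') ((G.P_mem _ _ _).1 s)
    · simp only [pushDist, Matrix.vecMul, dotProduct, detTransition, Matrix.of_apply]
      rw [Finset.sum_comm]
      simp_rw [← Finset.mul_sum, (G.P_mem _ _ _).2, mul_one]
      exact ih.2

theorem pushDist_congr {x x' : ℕ → S → A} {y y' : ℕ → S → B} {t : ℕ}
    (hx : ∀ i < t, x i = x' i) (hy : ∀ i < t, y i = y' i) :
    G.pushDist ρ x y t = G.pushDist ρ x' y' t := by
  induction t with
  | zero => rfl
  | succ t ih =>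
    simp only [pushDist]
    rw [ih (fun i hi => hx i (by omega)) fun i hi => hy i (by omega), hx t (by omega),
      hy t (by omega)]

/-- A crude bound, uniform in the policies and in t; it serves only to make the real suprema in
`concentrability` bounded, so that they are not default values. -/
theorem abs_pushDist_div_le (hρ : ρ ∈ stdSimplex ℝ S) (hpos : ∀ s, 0 < ρ s) (x : ℕ → S → A)
    (y : ℕ → S → B) (t : ℕ) (s : S) :
    |G.pushDist ρ x y t s / ρ s| ≤ ∑ s, 1 / ρ s := by
  have h := G.pushDist_mem hρ x y t
  rw [abs_of_nonneg (div_nonneg (h.1 s) (hpos s).le)]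
  refine le_trans ?_ (Finset.single_le_sum (f := fun s => 1 / ρ s)
    (fun s _ => (one_div_pos.2 (hpos s)).le) (Finset.mem_univ s))
  exact div_le_div_of_nonneg_right (le_one_of_mem_stdSimplex h s) (hpos s).le

theorem iSup_pushDist_div_le (hρ : ρ ∈ stdSimplex ℝ S) (hpos : ∀ s, 0 < ρ s) (x : ℕ → S → A)
    (y : ℕ → S → B) (t : ℕ) : ⨆ s, |G.pushDist ρ x y t s / ρ s| ≤ ∑ s, 1 / ρ s :=
  Real.iSup_le (G.abs_pushDist_div_le hρ hpos x y t)
    (Finset.sum_nonneg fun s _ => (one_div_pos.2 (hpos s)).le)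

theorem concentrabilityAt_le (hρ : ρ ∈ stdSimplex ℝ S) (hpos : ∀ s, 0 < ρ s) (t : ℕ) :
    G.concentrabilityAt ρ t ≤ ∑ s, 1 / ρ s :=
  Real.iSup_le (fun p => G.iSup_pushDist_div_le hρ hpos p.1 p.2 t)
    (Finset.sum_nonneg fun s _ => (one_div_pos.2 (hpos s)).le)

theorem pushDist_le (hρ : ρ ∈ stdSimplex ℝ S) (hpos : ∀ s, 0 < ρ s) (x : ℕ → S → A)
    (y : ℕ → S → B) (t : ℕ) (s : S) :
    G.pushDist ρ x y t s ≤ G.concentrability ρ * ρ s := by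
  rw [← div_le_iff₀ (hpos s)]
  refine (le_abs_self _).trans ?_
  refine (le_ciSup (f := fun s => |G.pushDist ρ x y t s / ρ s|)
    (Set.finite_range _).bddAbove s).trans ?_
  refine (le_ciSup (f := fun p : (ℕ → S → A) × (ℕ → S → B) =>
    ⨆ s, |G.pushDist ρ p.1 p.2 t s / ρ s|) ⟨∑ s, 1 / ρ s, ?_⟩ (x, y)).trans ?_
  · rintro _ ⟨p, rfl⟩
    exact G.iSup_pushDist_div_le hρ hpos p.1 p.2 t
  · refine le_ciSup (f := fun t => G.concentrabilityAt ρ t) ⟨∑ s, 1 / ρ s, ?_⟩ t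
    rintro _ ⟨t, rfl⟩
    exact G.concentrabilityAt_le hρ hpos t

/-- The largest expectation of `g` under the distributions reachable from `ρ` by sequences of
deterministic policy pairs. -/
noncomputable def reachSup (ρ g : S → ℝ) : ℝ :=
  ⨆ p : ℕ × (ℕ → S → A) × (ℕ → S → B), ∑ s, G.pushDist ρ p.2.1 p.2.2 p.1 s * g s

variable {G} {g h : S → ℝ}

theorem le_reachSup (hρ : ρ ∈ stdSimplex ℝ S) (g : S → ℝ) (x : ℕ → S → A) (y : ℕ → S → B)
    (t : ℕ) : ∑ s, G.pushDist ρ x y t s * g s ≤ G.reachSup ρ g := by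
  refine le_ciSup (f := fun p : ℕ × (ℕ → S → A) × (ℕ → S → B) =>
    ∑ s, G.pushDist ρ p.2.1 p.2.2 p.1 s * g s) ⟨∑ s, |g s|, ?_⟩ (t, x, y)
  rintro _ ⟨p, rfl⟩
  have hm := G.pushDist_mem hρ p.2.1 p.2.2 p.1
  refine Finset.sum_le_sum fun s _ => ?_
  have h1 := mul_le_mul_of_nonneg_left (le_abs_self (g s)) (hm.1 s)
  have h2 := mul_le_mul_of_nonneg_right (le_one_of_mem_stdSimplex hm s) (abs_nonneg (g s))
  linarith

variable [Nonempty A] [Nonempty B]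

theorem sum_le_reachSup (hρ : ρ ∈ stdSimplex ℝ S) (g : S → ℝ) :
    ∑ s, ρ s * g s ≤ G.reachSup ρ g :=
  le_reachSup hρ g (fun _ _ => Classical.arbitrary A) (fun _ _ => Classical.arbitrary B) 0

theorem one_le_concentrability (hρ : ρ ∈ stdSimplex ℝ S) (hpos : ∀ s, 0 < ρ s) :
    1 ≤ G.concentrability ρ := by
  have h1 := Finset.sum_le_sum fun s (_ : s ∈ Finset.univ) =>
    G.pushDist_le hρ hpos (fun _ _ => Classical.arbitrary A) (fun _ _ => Classical.arbitrary B) 0 s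
  rw [← Finset.mul_sum, hρ.2, mul_one] at h1
  exact hρ.2.symm.trans_le h1

theorem reachSup_le_of_forall_le (hρ : ρ ∈ stdSimplex ℝ S) {k : ℝ} (hg : ∀ s, g s ≤ k) :
    G.reachSup ρ g ≤ k := by
  refine ciSup_le fun p => ?_
  have hm := G.pushDist_mem hρ p.2.1 p.2.2 p.1
  calc ∑ s, G.pushDist ρ p.2.1 p.2.2 p.1 s * g s
      ≤ ∑ s, G.pushDist ρ p.2.1 p.2.2 p.1 s * k :=
        Finset.sum_le_sum fun s _ => mul_le_mul_of_nonneg_left (hg s) (hm.1 s)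
    _ = k := by rw [← Finset.sum_mul, hm.2, one_mul]

theorem reachSup_le_concentrability_mul (hρ : ρ ∈ stdSimplex ℝ S) (hpos : ∀ s, 0 < ρ s)
    (hg : ∀ s, 0 ≤ g s) :
    G.reachSup ρ g ≤ G.concentrability ρ * ∑ s, ρ s * g s := by
  refine ciSup_le fun p => ?_
  rw [Finset.mul_sum]
  refine Finset.sum_le_sum fun s _ => ?_
  rw [← mul_assoc]
  exact mul_le_mul_of_nonneg_right (G.pushDist_le hρ hpos _ _ _ s) (hg s)

/-- `reachSup` is monotone and sublinear. -/
theorem reachSup_le_combo (hρ : ρ ∈ stdSimplex ℝ S) {f g₁ g₂ g₃ : S → ℝ} {c₁ c₂ c₃ : ℝ}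
    (h₁ : 0 ≤ c₁) (h₂ : 0 ≤ c₂) (h₃ : 0 ≤ c₃)
    (hf : ∀ s, f s ≤ c₁ * g₁ s + c₂ * g₂ s + c₃ * g₃ s) :
    G.reachSup ρ f
      ≤ c₁ * G.reachSup ρ g₁ + c₂ * G.reachSup ρ g₂ + c₃ * G.reachSup ρ g₃ := by
  refine ciSup_le fun p => ?_
  have hm := G.pushDist_mem hρ p.2.1 p.2.2 p.1
  have e1 := mul_le_mul_of_nonneg_left (le_reachSup (G := G) hρ g₁ p.2.1 p.2.2 p.1) h₁
  have e2 := mul_le_mul_of_nonneg_left (le_reachSup (G := G) hρ g₂ p.2.1 p.2.2 p.1) h₂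
  have e3 := mul_le_mul_of_nonneg_left (le_reachSup (G := G) hρ g₃ p.2.1 p.2.2 p.1) h₃
  refine le_trans ?_ (add_le_add (add_le_add e1 e2) e3)
  simp only [Finset.mul_sum, ← Finset.sum_add_distrib]
  refine Finset.sum_le_sum fun s _ => ?_
  have := mul_le_mul_of_nonneg_left (hf s) (hm.1 s)
  linarith

/-- The chosen actions form a deterministic policy pair; appending its transition to a reachable
distribution gives another reachable distribution. With ρ alone in place of the supremum this step
would fail. -/
theorem reachSup_le_mul_of_forall_exists (hρ : ρ ∈ stdSimplex ℝ S)
    (hg : ∀ s, ∃ a b, g s ≤ G.γ * ∑ s', G.P s a b s' * h s') :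
    G.reachSup ρ g ≤ G.γ * G.reachSup ρ h := by
  choose x y hxy using hg
  refine ciSup_le fun p => ?_
  obtain ⟨t, x', y'⟩ := p
  have hm := G.pushDist_mem hρ x' y' t
  -- The distribution at time t reads only the entries with index below t, so overwriting entry t
  -- changes only the next transition.
  have hl := le_reachSup (G := G) hρ h (Function.update x' t x) (Function.update y' t y) (t + 1)
  have hc : G.pushDist ρ (Function.update x' t x) (Function.update y' t y) t
      = G.pushDist ρ x' y' t :=
    G.pushDist_congr (fun i hi => by simp [hi.ne]) fun i hi => by simp [hi.ne]
  have he : ∑ s, G.pushDist ρ (Function.update x' t x) (Function.update y' t y) (t + 1) s * h s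
      = ∑ s, G.pushDist ρ x' y' t s * ∑ s', G.P s (x s) (y s) s' * h s' := by
    simp only [pushDist, hc, Function.update_self, Matrix.vecMul, dotProduct, detTransition,
      Matrix.of_apply, Finset.sum_mul, Finset.mul_sum]
    rw [Finset.sum_comm]
    exact Finset.sum_congr rfl fun _ _ => Finset.sum_congr rfl fun _ _ => by ring
  rw [he] at hl
  refine le_trans ?_ (mul_le_mul_of_nonneg_left hl G.γ_nonneg)
  rw [Finset.mul_sum]
  refine Finset.sum_le_sum fun s _ => ?_
  have := mul_le_mul_of_nonneg_left (hxy s) (hm.1 s)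
  linarith

end Concentrability

end MarkovGame

/-! ### One OMWU step in a matrix game with a moving payoff matrix -/

section MatrixGameStep

/-- One step of entropy-regularized OMWU in a matrix game whose payoff matrix changes from `Q` to
`Q'`: the current points are `(m, n)`, the current extrapolated points `(mb, nb)`, and the new
ones `(m', n')` and `(mb', nb')`. -/
structure IsOMWUStep {A B : Type*} [Fintype A] [Fintype B] (c η : ℝ) (Q Q' : A → B → ℝ)
    (m mb m' mb' : A → ℝ) (n nb n' nb' : B → ℝ) : Prop where
  m_pos : ∀ a, 0 < m a
  n_pos : ∀ b, 0 < n b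
  m_mem : m ∈ stdSimplex ℝ A
  n_mem : n ∈ stdSimplex ℝ B
  mb_pos : ∀ a, 0 < mb a
  nb_pos : ∀ b, 0 < nb b
  mb_mem : mb ∈ stdSimplex ℝ A
  nb_mem : nb ∈ stdSimplex ℝ B
  mb_eq : mb' = multUpdate c m fun a => η * ∑ b, Q a b * nb b
  nb_eq : nb' = multUpdate c n fun b => η * ∑ a, -Q a b * mb a
  m_eq : m' = multUpdate c m fun a => η * ∑ b, Q' a b * nb' b
  n_eq : n' = multUpdate c n fun b => η * ∑ a, -Q' a b * mb' a

/-- Young's inequality, weighted so that only `k / 2` of the last divergence appears without the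
small factor `h`. -/
theorem mul_le_of_sq_le {h n₁ n₂ l q a b k : ℝ} (hh : 0 ≤ h)
    (h₁ : n₁ ^ 2 ≤ 4 * a) (h₂ : n₂ ^ 2 ≤ 4 * b) (hl : l ^ 2 ≤ 4 * k) :
    (h * (n₁ + n₂) + q) * l ≤ h * (2 * a + 2 * b + 4 * k) + 2 * q ^ 2 + k / 2 := by
  have e : (n₁ + n₂) * l ≤ 2 * a + 2 * b + 4 * k := by
    nlinarith [sq_nonneg (n₁ - l), sq_nonneg (n₂ - l)]
  have := mul_le_mul_of_nonneg_left e hh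
  nlinarith [sq_nonneg (4 * q - l)]

namespace IsOMWUStep

variable {A B : Type*} [Fintype A] [Fintype B] {c η : ℝ} {Q Q' : A → B → ℝ}
  {m mb m' mb' : A → ℝ} {n nb n' nb' : B → ℝ}

theorem swap (h : IsOMWUStep c η Q Q' m mb m' mb' n nb n' nb') :
    IsOMWUStep c η (fun b a => -Q a b) (fun b a => -Q' a b) n nb n' nb' m mb m' mb' where
  m_pos := h.n_pos
  n_pos := h.m_pos
  m_mem := h.n_mem
  n_mem := h.m_mem
  mb_pos := h.nb_pos
  nb_pos := h.mb_pos
  mb_mem := h.nb_mem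
  nb_mem := h.mb_mem
  mb_eq := h.nb_eq
  nb_eq := by simpa only [neg_neg] using h.mb_eq
  m_eq := h.n_eq
  n_eq := by simpa only [neg_neg] using h.m_eq

variable [Nonempty A]

theorem mb'_pos (h : IsOMWUStep c η Q Q' m mb m' mb' n nb n' nb') (a : A) : 0 < mb' a := by
  rw [h.mb_eq]
  exact multUpdate_pos h.m_pos a

theorem mb'_mem (h : IsOMWUStep c η Q Q' m mb m' mb' n nb n' nb') : mb' ∈ stdSimplex ℝ A := by
  rw [h.mb_eq]
  exact multUpdate_mem h.m_pos

theorem m'_pos (h : IsOMWUStep c η Q Q' m mb m' mb' n nb n' nb') (a : A) : 0 < m' a := by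
  rw [h.m_eq]
  exact multUpdate_pos h.m_pos a

theorem m'_mem (h : IsOMWUStep c η Q Q' m mb m' mb' n nb n' nb') : m' ∈ stdSimplex ℝ A := by
  rw [h.m_eq]
  exact multUpdate_mem h.m_pos

theorem regret_left (h : IsOMWUStep c η Q Q' m mb m' mb' n nb n' nb') {τ : ℝ}
    (hc : 1 - c = η * τ) {x : A → ℝ} (hx : x ∈ stdSimplex ℝ A) :
    η * (regPayoff τ Q' x nb' - regPayoff τ Q' mb' nb')
      = c * klVec x m - klVec x m' + (klVec mb' m' - c * klVec mb' m) := by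
  have h1 := multUpdate_regret (c := c) (w := fun a => η * ∑ b, Q' a b * nb' b) h.m_pos hx
    h.mb'_mem
  have e : ∀ z : A → ℝ, ∑ a, z a * (η * ∑ b, Q' a b * nb' b) = η * bilin z Q' nb' := by
    intro z
    rw [bilin_eq_sum_left, Finset.mul_sum]
    exact Finset.sum_congr rfl fun a _ => by ring
  rw [← h.m_eq, e, e, hc] at h1
  rw [← h1, regPayoff, regPayoff]
  ring

variable [Nonempty B]

/-- The gradient change splits into a policy part, routed from `nb'` through `n` to `nb`, and a
matrix part of size `q`. Weak Pinsker turns the ℓ¹ distances into divergences. -/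
theorem drift_le (h : IsOMWUStep c η Q Q' m mb m' mb' n nb n' nb') (hη : 0 ≤ η) {k q : ℝ}
    (hk : 0 ≤ k) (hQ : ∀ a b, |Q' a b| ≤ k) (hq : ∀ a b, |Q' a b - Q a b| ≤ q) {x : A → ℝ}
    (hx : x ∈ stdSimplex ℝ A) :
    ∑ a, (η * ∑ b, Q' a b * nb' b - η * ∑ b, Q a b * nb b) * (x a - mb' a)
      ≤ η * k * (2 * klVec nb' n + 2 * klVec n nb + 4 * klVec x mb') + 2 * (η * q) ^ 2
        + klVec x mb' / 2 := by
  have h1 : ∀ a, |η * ∑ b, Q' a b * nb' b - η * ∑ b, Q a b * nb b|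
      ≤ η * k * (l1Dist nb' n + l1Dist n nb) + η * q := by
    intro a
    have e : η * ∑ b, Q' a b * nb' b - η * ∑ b, Q a b * nb b
        = η * (∑ b, Q' a b * (nb' b - nb b) + ∑ b, (Q' a b - Q a b) * nb b) := by
      rw [← mul_sub, ← Finset.sum_sub_distrib, ← Finset.sum_add_distrib]
      congr 1
      exact Finset.sum_congr rfl fun b _ => by ring
    rw [e, abs_mul, abs_of_nonneg hη, mul_assoc, ← mul_add]
    refine mul_le_mul_of_nonneg_left ((abs_add_le _ _).trans (add_le_add ?_ ?_)) hη
    · refine le_trans ?_ (mul_le_mul_of_nonneg_left (l1Dist_triangle nb' n nb) hk)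
      rw [abs_le']
      refine ⟨sum_mul_le_mul_l1Dist (hQ a), ?_⟩
      rw [← Finset.sum_neg_distrib]
      simp_rw [← neg_mul]
      exact sum_mul_le_mul_l1Dist fun b => by rw [abs_neg]; exact hQ a b
    · exact abs_sum_mul_le h.nb_mem (hq a)
  refine (sum_mul_le_mul_l1Dist h1).trans ?_
  exact mul_le_of_sq_le (mul_nonneg hη hk) (l1Dist_sq_le h.swap.mb'_mem h.n_mem h.n_pos)
    (l1Dist_sq_le h.n_mem h.nb_mem h.nb_pos) (l1Dist_sq_le hx h.mb'_mem h.mb'_pos)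

/-- `m'` and `mb'` are updates of the same point with different gradients, so their symmetrized
divergence equals the drift tested against `m' - mb'`. Half of `klVec m' mb'` survives with a
negative sign. -/
theorem err_left_le (h : IsOMWUStep c η Q Q' m mb m' mb' n nb n' nb') (hη : 0 ≤ η) {k q : ℝ}
    (hk : 0 ≤ k) (hQ : ∀ a b, |Q' a b| ≤ k) (hq : ∀ a b, |Q' a b - Q a b| ≤ q) :
    klVec mb' m' - c * klVec mb' m
      ≤ η * k * (2 * klVec nb' n + 2 * klVec n nb + 4 * klVec m' mb') + 2 * (η * q) ^ 2
        - klVec m' mb' / 2 - c * klVec mb' m := by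
  have h1 := h.drift_le hη hk hQ hq h.m'_mem
  have h2 := klVec_multUpdate_sub (c := c) (w := fun a => η * ∑ b, Q' a b * nb' b)
    (v := fun a => η * ∑ b, Q a b * nb b) h.m_pos h.m'_mem h.mb'_mem
  rw [← h.m_eq, ← h.mb_eq, klVec_self, klVec_self] at h2
  linarith

/-- Transfers closeness to `x` from `m'` to the extrapolated point: the drift costs at most 4/16 +
1/2 of `klVec x mb'`, leaving a quarter. -/
theorem klVec_bar_left_le (h : IsOMWUStep c η Q Q' m mb m' mb' n nb n' nb') (hη : 0 ≤ η)
    {k q : ℝ} (hk : 0 ≤ k) (hQ : ∀ a b, |Q' a b| ≤ k) (hq : ∀ a b, |Q' a b - Q a b| ≤ q)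
    (hkη : η * k ≤ 1 / 16) {x : A → ℝ} (hx : x ∈ stdSimplex ℝ A) :
    klVec x mb' / 4
      ≤ klVec x m' + η * k * (2 * klVec nb' n + 2 * klVec n nb) + 2 * (η * q) ^ 2 := by
  have h1 := h.drift_le hη hk hQ hq hx
  have h2 := klVec_multUpdate_sub (c := c) (w := fun a => η * ∑ b, Q' a b * nb' b)
    (v := fun a => η * ∑ b, Q a b * nb b) h.m_pos hx h.mb'_mem
  rw [← h.m_eq, ← h.mb_eq, klVec_self] at h2
  have h3 := klVec_nonneg h.mb'_mem h.m'_mem h.m'_pos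
  have h4 := klVec_nonneg hx h.mb'_mem h.mb'_pos
  have h5 := mul_le_mul_of_nonneg_right hkη h4
  linarith

variable {τ k q d : ℝ} {Qs : A → B → ℝ} {x : A → ℝ} {y : B → ℝ}

/-- One player's regret bound. The saddle property replaces `y` by `nb'`, and passing from `Qs` to
`Q'` costs `d`. The divergence is kept on the left so that it can join the value error in
`valuePotential`. -/
theorem regPayoff_bar_ge (h : IsOMWUStep c η Q Q' m mb m' mb' n nb n' nb') (hη : 0 < η)
    (hk : 0 ≤ k) (hQ : ∀ a b, |Q' a b| ≤ k) (hq : ∀ a b, |Q' a b - Q a b| ≤ q)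
    (hd : ∀ a b, |Q' a b - Qs a b| ≤ d) (hkη : η * k ≤ 1 / 16) (hc0 : 0 ≤ c)
    (hc : 1 - c = η * τ) (hx : x ∈ stdSimplex ℝ A) (hs : IsRegSaddle τ Qs x y) :
    η * (regPayoff τ Qs x y - regPayoff τ Q' mb' nb') + klVec x m'
      ≤ c * klVec x m + η * d + 2 * (η * k)
        * (klVec mb' m + klVec nb' n + (klVec m mb + klVec n nb)) + 2 * (η * q) ^ 2 := by
  have h1 := h.regret_left hc hx
  have h2 := h.err_left_le hη.le hk hQ hq
  have hnb := h.swap.mb'_mem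
  have h3 := hs.2 nb' hnb
  have h4 := (abs_le.1 (regPayoff_sub_le (τ := τ) hx hnb hd)).1
  have p1 := klVec_nonneg h.m'_mem h.mb'_mem h.mb'_pos
  have p2 := mul_nonneg hc0 (klVec_nonneg h.mb'_mem h.m_mem h.m_pos)
  -- `p3` and `p4` pad the error with the max player's own terms, to make it symmetric in the
  -- players.
  have p3 := mul_nonneg (mul_nonneg hη.le hk) (klVec_nonneg h.mb'_mem h.m_mem h.m_pos)
  have p4 := mul_nonneg (mul_nonneg hη.le hk) (klVec_nonneg h.m_mem h.mb_mem h.mb_pos)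
  have p5 := mul_le_mul_of_nonneg_right hkη p1
  have h5 : η * (regPayoff τ Qs x y - regPayoff τ Q' mb' nb')
      ≤ η * d + η * (regPayoff τ Q' x nb' - regPayoff τ Q' mb' nb') := by
    rw [← mul_add]
    exact mul_le_mul_of_nonneg_left (by linarith) hη.le
  linarith

theorem regPayoff_bar_le (h : IsOMWUStep c η Q Q' m mb m' mb' n nb n' nb') (hη : 0 < η)
    (hk : 0 ≤ k) (hQ : ∀ a b, |Q' a b| ≤ k) (hq : ∀ a b, |Q' a b - Q a b| ≤ q)
    (hd : ∀ a b, |Q' a b - Qs a b| ≤ d) (hkη : η * k ≤ 1 / 16) (hc0 : 0 ≤ c)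
    (hc : 1 - c = η * τ) (hy : y ∈ stdSimplex ℝ B) (hs : IsRegSaddle τ Qs x y) :
    η * (regPayoff τ Q' mb' nb' - regPayoff τ Qs x y) + klVec y n'
      ≤ c * klVec y n + η * d + 2 * (η * k)
        * (klVec mb' m + klVec nb' n + (klVec m mb + klVec n nb)) + 2 * (η * q) ^ 2 := by
  have h1 := h.swap.regPayoff_bar_ge (τ := τ) (k := k) (q := q) (d := d)
    (Qs := fun b a => -Qs a b) (x := y) (y := x) hη hk
    (fun b a => by rw [abs_neg]; exact hQ a b)
    (fun b a => by rw [neg_sub_neg, abs_sub_comm]; exact hq a b)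
    (fun b a => by rw [neg_sub_neg, abs_sub_comm]; exact hd a b) hkη hc0 hc hy hs.swap
  rw [regPayoff_swap, regPayoff_swap] at h1
  linarith

/-- Adding the two regrets cancels the payoff at `(mb', nb')`, and the saddle property makes the
remaining duality gap at least `-2 * d`. The coefficients are 1/2 - 2/16 = 3/8 and 1/2 - 4/16 = 1/4.
-/
theorem klVec_add_le (h : IsOMWUStep c η Q Q' m mb m' mb' n nb n' nb') (hη : 0 < η)
    (hk : 0 ≤ k) (hQ : ∀ a b, |Q' a b| ≤ k) (hq : ∀ a b, |Q' a b - Q a b| ≤ q)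
    (hd : ∀ a b, |Q' a b - Qs a b| ≤ d) (hkη : η * k ≤ 1 / 16) (hc2 : 1 / 2 ≤ c)
    (hc : 1 - c = η * τ) (hx : x ∈ stdSimplex ℝ A) (hy : y ∈ stdSimplex ℝ B)
    (hs : IsRegSaddle τ Qs x y) :
    klVec x m' + klVec y n' + (klVec mb' m + klVec nb' n) * (3 / 8)
        + (klVec m' mb' + klVec n' nb') / 4
      ≤ c * (klVec x m + klVec y n) + 2 * (η * d) + 2 * (η * k) * (klVec m mb + klVec n nb)
        + 4 * (η * q) ^ 2 := by
  have h1 := h.regret_left hc hx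
  have h2 := h.err_left_le hη.le hk hQ hq
  have h1' := h.swap.regret_left hc hy
  have h2' := h.swap.err_left_le hη.le hk
    (fun b a => by rw [abs_neg]; exact hQ a b)
    (fun b a => by rw [neg_sub_neg, abs_sub_comm]; exact hq a b)
  rw [regPayoff_swap, regPayoff_swap] at h1'
  have hnb := h.swap.mb'_mem
  have hmb := h.mb'_mem
  have h3 := hs.2 nb' hnb
  have h3' := hs.1 mb' hmb
  have h4 := (abs_le.1 (regPayoff_sub_le (τ := τ) hx hnb hd)).1
  have h4' := (abs_le.1 (regPayoff_sub_le (τ := τ) hmb hy hd)).2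
  have h5 : 0 ≤ η * (2 * d + regPayoff τ Q' x nb' - regPayoff τ Q' mb' y) :=
    mul_nonneg hη.le (by linarith)
  have p1 := klVec_nonneg h.m'_mem h.mb'_mem h.mb'_pos
  have p1' := klVec_nonneg h.swap.m'_mem h.swap.mb'_mem h.swap.mb'_pos
  have p2 := klVec_nonneg h.mb'_mem h.m_mem h.m_pos
  have p2' := klVec_nonneg h.swap.mb'_mem h.n_mem h.n_pos
  have e1 := mul_le_mul_of_nonneg_right hkη (add_nonneg p1 p1')
  have e2 := mul_le_mul_of_nonneg_right hkη (add_nonneg p2 p2')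
  have e3 := mul_le_mul_of_nonneg_right hc2 (add_nonneg p2 p2')
  linarith

end IsOMWUStep

end MatrixGameStep

/-! ### Positivity and boundedness of the iterates -/

namespace OMWUState

/-- The iterate consists of strictly positive policies and of values bounded by `k`. -/
structure IsBounded {S A B : Type*} [Fintype A] [Fintype B] (k : ℝ) (z : OMWUState S A B) :
    Prop where
  mu_pos : ∀ s a, 0 < z.mu s a
  nu_pos : ∀ s b, 0 < z.nu s b
  muBar_pos : ∀ s a, 0 < z.muBar s a
  nuBar_pos : ∀ s b, 0 < z.nuBar s b
  mu_mem : IsPolicy z.mu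
  nu_mem : IsPolicy z.nu
  muBar_mem : IsPolicy z.muBar
  nuBar_mem : IsPolicy z.nuBar
  abs_Q_le : ∀ s a b, |z.Q s a b| ≤ k
  abs_V_le : ∀ s, |z.V s| ≤ k

end OMWUState

namespace MarkovGame

theorem isBounded_omwuInit {S A B : Type*} [Fintype A] [Fintype B] [Nonempty A] [Nonempty B]
    {τ : ℝ} (hτ : 0 ≤ τ)
    (hτ1 : τ * (Real.log (Fintype.card A) + Real.log (Fintype.card B)) ≤ 1) {k : ℝ} (hk : 1 ≤ k) :
    (omwuInit S A B τ).IsBounded k where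
  mu_pos _ _ := by simp only [omwuInit]; positivity
  nu_pos _ _ := by simp only [omwuInit]; positivity
  muBar_pos _ _ := by simp only [omwuInit]; positivity
  nuBar_pos _ _ := by simp only [omwuInit]; positivity
  mu_mem _ := uniform_mem_stdSimplex
  nu_mem _ := uniform_mem_stdSimplex
  muBar_mem _ := uniform_mem_stdSimplex
  nuBar_mem _ := uniform_mem_stdSimplex
  abs_Q_le _ _ _ := by simp only [omwuInit, abs_zero]; linarith
  abs_V_le _ := by
    have h1 := mul_nonneg hτ (log_card_nonneg A)
    have h2 := mul_nonneg hτ (log_card_nonneg B)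
    simp only [omwuInit]
    rw [abs_le]
    constructor <;> linarith

section OMWU

variable {S A B : Type*} [Fintype S] [Fintype A] [Fintype B] {G : MarkovGame S A B}
  {τ η : ℝ} {z : OMWUState S A B}

theorem isOMWUStep_omwuStep {k : ℝ} (α : ℝ) (hz : z.IsBounded k) (s : S) :
    IsOMWUStep (1 - η * τ) η (z.Q s) ((G.omwuStep τ η α z).Q s)
      (z.mu s) (z.muBar s) ((G.omwuStep τ η α z).mu s) ((G.omwuStep τ η α z).muBar s)
      (z.nu s) (z.nuBar s) ((G.omwuStep τ η α z).nu s) ((G.omwuStep τ η α z).nuBar s) where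
  m_pos := hz.mu_pos s
  n_pos := hz.nu_pos s
  m_mem := hz.mu_mem s
  n_mem := hz.nu_mem s
  mb_pos := hz.muBar_pos s
  nb_pos := hz.nuBar_pos s
  mb_mem := hz.muBar_mem s
  nb_mem := hz.nuBar_mem s
  mb_eq := rfl
  nb_eq := by simp [omwuStep, Finset.sum_neg_distrib]
  m_eq := rfl
  n_eq := by simp [omwuStep, Finset.sum_neg_distrib]

variable [Nonempty A] [Nonempty B]

theorem isBounded_omwuStep (hτ : 0 ≤ τ)
    (hτ1 : τ * (Real.log (Fintype.card A) + Real.log (Fintype.card B)) ≤ 1) {k α : ℝ}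
    (hk : 1 + G.γ * k + 1 ≤ k) (hα0 : 0 ≤ α) (hα1 : α ≤ 1) (hz : z.IsBounded k) :
    (G.omwuStep τ η α z).IsBounded k := by
  have hstep := fun s => isOMWUStep_omwuStep (G := G) (τ := τ) (η := η) α hz s
  have hQ : ∀ s a b, |(G.omwuStep τ η α z).Q s a b| ≤ 1 + G.γ * k :=
    G.abs_lookahead_le hz.abs_V_le
  refine
    { mu_pos := fun s => (hstep s).m'_pos
      nu_pos := fun s => (hstep s).swap.m'_pos
      muBar_pos := fun s => (hstep s).mb'_pos
      nuBar_pos := fun s => (hstep s).swap.mb'_pos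
      mu_mem := fun s => (hstep s).m'_mem
      nu_mem := fun s => (hstep s).swap.m'_mem
      muBar_mem := fun s => (hstep s).mb'_mem
      nuBar_mem := fun s => (hstep s).swap.mb'_mem
      abs_Q_le := fun s a b => (hQ s a b).trans (by linarith)
      abs_V_le := fun s => ?_ }
  have h1 := abs_le.1 ((abs_regPayoff_le hτ hτ1 (hstep s).mb'_mem (hstep s).swap.mb'_mem
    (hQ s)).trans hk)
  have h2 := abs_le.1 (hz.abs_V_le s)
  have e : (G.omwuStep τ η α z).V s = (1 - α) * z.V s + α * regPayoff τ
      ((G.omwuStep τ η α z).Q s) ((G.omwuStep τ η α z).muBar s)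
      ((G.omwuStep τ η α z).nuBar s) := rfl
  rw [e, abs_le]
  have h3 := sub_nonneg.2 hα1
  constructor
  · linarith [mul_le_mul_of_nonneg_left h1.1 hα0, mul_le_mul_of_nonneg_left h2.1 h3]
  · linarith [mul_le_mul_of_nonneg_left h1.2 hα0, mul_le_mul_of_nonneg_left h2.2 h3]

end OMWU

/-! ### One-step inequalities at a fixed state -/

section Potential

variable {S A B : Type*} [Fintype S] [DecidableEq S] [Fintype A] [Fintype B]

/-- The distance of the iterate's `Q`-matrix at `s` to the one of the policy pair `ζ`. -/
noncomputable def qGap (G : MarkovGame S A B) (τ : ℝ) (ζ : (S → A → ℝ) × (S → B → ℝ))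
    (z : OMWUState S A B) (s : S) : ℝ :=
  maxEntry fun a b => z.Q s a b - G.qValue τ ζ.1 ζ.2 s a b

/-- A majorant of the value error at `s` which absorbs the regrets of the players. -/
noncomputable def valuePotential (G : MarkovGame S A B) (τ : ℝ)
    (ζ : (S → A → ℝ) × (S → B → ℝ)) (z : OMWUState S A B) (s : S) : ℝ :=
  max (z.V s - G.value τ ζ.1 ζ.2 s + τ * klVec (ζ.2 s) (z.nu s))
    (G.value τ ζ.1 ζ.2 s - z.V s + τ * klVec (ζ.1 s) (z.mu s))

/-- `KL(ζ(s) ‖ ζ'(s))`. -/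
noncomputable def klAt (ζ ζ' : (S → A → ℝ) × (S → B → ℝ)) (s : S) : ℝ :=
  klVec (ζ.1 s) (ζ'.1 s) + klVec (ζ.2 s) (ζ'.2 s)

variable {G : MarkovGame S A B} {τ η k : ℝ} {ζ : (S → A → ℝ) × (S → B → ℝ)}
  {z : OMWUState S A B}

theorem abs_sub_value_le_valuePotential (hτ : 0 ≤ τ) (hζ : G.IsQRE τ ζ) (hz : z.IsBounded k)
    (s : S) : |z.V s - G.value τ ζ.1 ζ.2 s| ≤ G.valuePotential τ ζ z s := by
  have h1 := mul_nonneg hτ (klVec_nonneg (hζ.1 s) (hz.mu_mem s) (hz.mu_pos s))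
  have h2 := mul_nonneg hτ (klVec_nonneg (hζ.2.1 s) (hz.nu_mem s) (hz.nu_pos s))
  rw [abs_le', valuePotential]
  exact ⟨le_max_of_le_left (by linarith), le_max_of_le_right (by linarith)⟩

/-- One factor of the square is bounded crudely by 2k, the other by the triangle inequality through
the equilibrium matrix. The quadratic error thus becomes linear in the Q errors, with a small
coefficient. -/
theorem sq_mul_maxEntry_le [Nonempty A] [Nonempty B] (hη : 0 ≤ η) {z' : OMWUState S A B}
    (hz : z.IsBounded k) (hz' : z'.IsBounded k) (s : S) :
    (η * maxEntry fun a b => z'.Q s a b - z.Q s a b) ^ 2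
      ≤ 2 * (η * k) * (η * (G.qGap τ ζ z s + G.qGap τ ζ z' s)) := by
  obtain ⟨a, b, hab⟩ := exists_maxEntry_eq fun a b => z'.Q s a b - z.Q s a b
  rw [hab]
  set Qs := G.qValue τ ζ.1 ζ.2 s a b
  have h1 : |z'.Q s a b - z.Q s a b| ≤ 2 * k := by
    have := abs_le.1 (hz.abs_Q_le s a b)
    have := abs_le.1 (hz'.abs_Q_le s a b)
    rw [abs_le]
    constructor <;> linarith
  have h2 : |z'.Q s a b - z.Q s a b| ≤ G.qGap τ ζ z s + G.qGap τ ζ z' s := by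
    have h3 := abs_le.1 (abs_le_maxEntry (fun a b => z.Q s a b - G.qValue τ ζ.1 ζ.2 s a b) a b)
    have h4 := abs_le.1 (abs_le_maxEntry (fun a b => z'.Q s a b - G.qValue τ ζ.1 ζ.2 s a b) a b)
    unfold qGap
    rw [abs_le]
    constructor <;> linarith
  have h0 := abs_nonneg (z'.Q s a b - z.Q s a b)
  calc (η * |z'.Q s a b - z.Q s a b|) ^ 2
      = (η * |z'.Q s a b - z.Q s a b|) * (η * |z'.Q s a b - z.Q s a b|) := sq _
    _ ≤ (η * (2 * k)) * (η * (G.qGap τ ζ z s + G.qGap τ ζ z' s)) :=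
        mul_le_mul (mul_le_mul_of_nonneg_left h1 hη) (mul_le_mul_of_nonneg_left h2 hη)
          (mul_nonneg hη h0) (mul_nonneg hη (h0.trans h1))
    _ = _ := by ring

variable [Nonempty A] [Nonempty B]

/-- The pair is the one attaining the largest entry; it later acts as a deterministic policy pair in
`reachSup_le_mul_of_forall_exists`. -/
theorem exists_qGap_omwuStep_le (hτ : 0 ≤ τ) (α : ℝ) (hζ : G.IsQRE τ ζ) (hz : z.IsBounded k)
    (s : S) : ∃ a b, G.qGap τ ζ (G.omwuStep τ η α z) s
      ≤ G.γ * ∑ s', G.P s a b s' * G.valuePotential τ ζ z s' := by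
  obtain ⟨a, b, hab⟩ := exists_maxEntry_eq
    fun a b => (G.omwuStep τ η α z).Q s a b - G.qValue τ ζ.1 ζ.2 s a b
  refine ⟨a, b, ?_⟩
  rw [qGap, hab]
  change |G.lookahead z.V s a b - G.lookahead (G.value τ ζ.1 ζ.2) s a b| ≤ _
  rw [lookahead_sub, abs_mul, abs_of_nonneg G.γ_nonneg]
  refine mul_le_mul_of_nonneg_left ((Finset.abs_sum_le_sum_abs _ _).trans ?_) G.γ_nonneg
  refine Finset.sum_le_sum fun s' _ => ?_
  rw [abs_mul, abs_of_nonneg ((G.P_mem s a b).1 s')]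
  exact mul_le_mul_of_nonneg_left (abs_sub_value_le_valuePotential hτ hζ hz s')
    ((G.P_mem s a b).1 s')

theorem klAt_omwuStep_le (hη : 0 < η) (hk : 0 ≤ k) (hkη : η * k ≤ 1 / 16)
    (hc : 1 / 2 ≤ 1 - η * τ) {α : ℝ} (hζ : G.IsQRE τ ζ) (hz : z.IsBounded k)
    (hz' : (G.omwuStep τ η α z).IsBounded k) (s : S) :
    klAt ζ (G.omwuStep τ η α z).zeta s + 3 / 8 * klAt (G.omwuStep τ η α z).zetaBar z.zeta s
        + 1 / 4 * klAt (G.omwuStep τ η α z).zeta (G.omwuStep τ η α z).zetaBar s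
      ≤ (1 - η * τ) * klAt ζ z.zeta s + 2 * η * G.qGap τ ζ (G.omwuStep τ η α z) s
        + 2 * (η * k) * klAt z.zeta z.zetaBar s
        + 8 * (η * k) * η * (G.qGap τ ζ z s + G.qGap τ ζ (G.omwuStep τ η α z) s) := by
  have h1 := (isOMWUStep_omwuStep (G := G) (τ := τ) (η := η) α hz s).klVec_add_le hη hk
    (hz'.abs_Q_le s) (abs_le_maxEntry _) (abs_le_maxEntry _) hkη hc (by ring) (hζ.1 s) (hζ.2.1 s)
    (hζ.isRegSaddle s)
  have h2 := sq_mul_maxEntry_le (G := G) (τ := τ) (ζ := ζ) hη.le hz hz' s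
  simp only [klAt, OMWUState.zeta, OMWUState.zetaBar]
  simp only [qGap] at h2 ⊢
  linarith

/-- Multiply each player's regret bound by τ and add it to the signed value update. The payoff
differences match because the value step size is ητ, and both parts of the potential acquire the
factor 1 - ητ. -/
theorem valuePotential_omwuStep_le (hτ : 0 ≤ τ) (hη : 0 < η) (hk : 0 ≤ k) (hkη : η * k ≤ 1 / 16)
    (hc : 0 ≤ 1 - η * τ) (hζ : G.IsQRE τ ζ) (hz : z.IsBounded k)
    (hz' : (G.omwuStep τ η (η * τ) z).IsBounded k) (s : S) :
    G.valuePotential τ ζ (G.omwuStep τ η (η * τ) z) s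
      ≤ (1 - η * τ) * G.valuePotential τ ζ z s
        + η * τ * G.qGap τ ζ (G.omwuStep τ η (η * τ) z) s
        + τ * (2 * (η * k) * (klAt (G.omwuStep τ η (η * τ) z).zetaBar z.zeta s
              + klAt z.zeta z.zetaBar s)
            + 4 * (η * k) * η
              * (G.qGap τ ζ z s + G.qGap τ ζ (G.omwuStep τ η (η * τ) z) s)) := by
  have hst := isOMWUStep_omwuStep (G := G) (τ := τ) (η := η) (η * τ) hz s
  have h1 := hst.regPayoff_bar_ge hη hk
    (hz'.abs_Q_le s) (abs_le_maxEntry _) (abs_le_maxEntry _) hkη hc (by ring) (hζ.1 s)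
    (hζ.isRegSaddle s)
  have h1' := hst.regPayoff_bar_le hη hk
    (hz'.abs_Q_le s) (abs_le_maxEntry _) (abs_le_maxEntry _) hkη hc (by ring) (hζ.2.1 s)
    (hζ.isRegSaddle s)
  have h2 := sq_mul_maxEntry_le (G := G) (τ := τ) (ζ := ζ) hη.le hz hz' s
  have e : (G.omwuStep τ η (η * τ) z).V s = (1 - η * τ) * z.V s + η * τ * regPayoff τ
      ((G.omwuStep τ η (η * τ) z).Q s) ((G.omwuStep τ η (η * τ) z).muBar s)
      ((G.omwuStep τ η (η * τ) z).nuBar s) := rfl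
  have hV : G.value τ ζ.1 ζ.2 s = regPayoff τ (G.qValue τ ζ.1 ζ.2 s) (ζ.1 s) (ζ.2 s) :=
    value_eq_bellman hζ.1 hζ.2.1 s
  rw [← hV] at h1 h1'
  have h3 := mul_le_mul_of_nonneg_left h1 hτ
  have h3' := mul_le_mul_of_nonneg_left h1' hτ
  have h2' := mul_le_mul_of_nonneg_left h2 hτ
  have h4 := mul_le_mul_of_nonneg_left (le_max_left
    (z.V s - G.value τ ζ.1 ζ.2 s + τ * klVec (ζ.2 s) (z.nu s))
    (G.value τ ζ.1 ζ.2 s - z.V s + τ * klVec (ζ.1 s) (z.mu s))) hc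
  have h4' := mul_le_mul_of_nonneg_left (le_max_right
    (z.V s - G.value τ ζ.1 ζ.2 s + τ * klVec (ζ.2 s) (z.nu s))
    (G.value τ ζ.1 ζ.2 s - z.V s + τ * klVec (ζ.1 s) (z.mu s))) hc
  rw [valuePotential, e]
  simp only [klAt, OMWUState.zeta, OMWUState.zetaBar, valuePotential]
  simp only [qGap] at h2' ⊢
  refine max_le ?_ ?_ <;> linarith

theorem klAt_zetaBar_omwuStep_le (hη : 0 < η) (hk : 0 ≤ k) (hkη : η * k ≤ 1 / 16)
    {α : ℝ} (hζ : G.IsQRE τ ζ) (hz : z.IsBounded k)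
    (hz' : (G.omwuStep τ η α z).IsBounded k) (s : S) :
    1 / 4 * klAt ζ (G.omwuStep τ η α z).zetaBar s
      ≤ klAt ζ (G.omwuStep τ η α z).zeta s
        + 2 * (η * k) * (klAt (G.omwuStep τ η α z).zetaBar z.zeta s + klAt z.zeta z.zetaBar s)
        + 8 * (η * k) * η * (G.qGap τ ζ z s + G.qGap τ ζ (G.omwuStep τ η α z) s) := by
  have hst := isOMWUStep_omwuStep (G := G) (τ := τ) (η := η) α hz s
  have h1 := hst.klVec_bar_left_le hη.le hk
    (hz'.abs_Q_le s) (abs_le_maxEntry _) hkη (hζ.1 s)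
  have h1' := hst.swap.klVec_bar_left_le hη.le hk
    (q := maxEntry fun a b => (G.omwuStep τ η α z).Q s a b - z.Q s a b)
    (fun b a => by rw [abs_neg]; exact hz'.abs_Q_le s a b)
    (fun b a => by
      rw [neg_sub_neg, abs_sub_comm]
      exact abs_le_maxEntry (fun a b => (G.omwuStep τ η α z).Q s a b - z.Q s a b) a b)
    hkη (hζ.2.1 s)
  have h2 := sq_mul_maxEntry_le (G := G) (τ := τ) (ζ := ζ) hη.le hz hz' s
  simp only [klAt, OMWUState.zeta, OMWUState.zetaBar]
  linarith

end Potential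

end MarkovGame

/-! ### Weighted expectations and the scalar recursion -/

/-- Expectation of `g` under the weights `ρ`. -/
def expect {S : Type*} [Fintype S] (ρ g : S → ℝ) : ℝ := ∑ s, ρ s * g s

section Expect

variable {S : Type*} [Fintype S] {ρ : S → ℝ}

theorem expect_add (f g : S → ℝ) :
    expect ρ (fun s => f s + g s) = expect ρ f + expect ρ g := by
  simp only [expect, mul_add, Finset.sum_add_distrib]

theorem expect_const_mul (c : ℝ) (g : S → ℝ) : expect ρ (fun s => c * g s) = c * expect ρ g := by
  simp only [expect, Finset.mul_sum, mul_left_comm]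

theorem expect_mono (hρ : ρ ∈ stdSimplex ℝ S) {f g : S → ℝ} (h : ∀ s, f s ≤ g s) :
    expect ρ f ≤ expect ρ g :=
  Finset.sum_le_sum fun s _ => mul_le_mul_of_nonneg_left (h s) (hρ.1 s)

theorem expect_nonneg (hρ : ρ ∈ stdSimplex ℝ S) {g : S → ℝ} (h : ∀ s, 0 ≤ g s) :
    0 ≤ expect ρ g :=
  Finset.sum_nonneg fun s _ => mul_nonneg (hρ.1 s) (h s)

theorem expect_le_of_forall_le (hρ : ρ ∈ stdSimplex ℝ S) {g : S → ℝ} {k : ℝ} (h : ∀ s, g s ≤ k) :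
    expect ρ g ≤ k := by
  refine (expect_mono hρ h).trans_eq ?_
  rw [expect, ← Finset.sum_mul, hρ.2, one_mul]

end Expect

/-- `E` contracts by 1 - δητ, so the weight 8 / (τδ) makes it release 8ηE. Of this, 2ηE is kept for
the rate δητ/4, and the rest pays for the Q errors via `D' ≤ E`. Since the weight carries 1/δ, the
bound on `C * H` makes the weighted errors at most 1/2000 of the quantities they multiply. -/
theorem coupled_recursion_le {δ η τ H C K K' E E' D D' a b b' : ℝ} (hδ0 : 0 < δ) (hδ1 : δ ≤ 1)
    (hη : 0 < η) (hτ : 0 < τ) (hητ : η * τ ≤ 1 / 2) (hH : 0 ≤ H) (hC : 1 ≤ C)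
    (hCH : C * H ≤ δ ^ 2 / 16000) (hK : 0 ≤ K) (hD : 0 ≤ D) (hD' : 0 ≤ D')
    (ha : 0 ≤ a) (hb : 0 ≤ b)
    (h₁ : K' + 3 / 8 * a + 1 / 4 * b'
      ≤ (1 - η * τ) * K + 2 * η * D' + 2 * H * b + 8 * H * η * (D + D'))
    (h₂ : E' ≤ (1 - η * τ) * E + η * τ * ((1 - δ) * E)
      + τ * (C * (2 * H * (a + b) + 4 * H * η * (D + D'))))
    (h₃ : D' ≤ E) :
    K' + 8 / (τ * δ) * E' + η * D' + 1 / 4 * b' + 1 / 4 * a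
      ≤ (1 - δ * η * τ / 4) * (K + 8 / (τ * δ) * E + η * D + 1 / 4 * b) := by
  have hκ : 0 ≤ 8 / (τ * δ) := by positivity
  have e2 := mul_le_mul_of_nonneg_left h₂ hκ
  have e2' : 8 / (τ * δ) * ((1 - η * τ) * E + η * τ * ((1 - δ) * E)
      + τ * (C * (2 * H * (a + b) + 4 * H * η * (D + D'))))
      = 8 / (τ * δ) * E - 8 * (η * E)
        + 8 * (C * H) / δ * (2 * (a + b) + 4 * (η * D + η * D')) := by
    field_simp
    ring
  have e3 : (1 - δ * η * τ / 4) * (K + 8 / (τ * δ) * E + η * D + 1 / 4 * b)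
      = K - δ * (η * τ) / 4 * K + 8 / (τ * δ) * E - 2 * (η * E)
        + (1 - δ * (η * τ) / 4) * (η * D + 1 / 4 * b) := by
    field_simp
    ring
  rw [e2'] at e2
  rw [e3]
  have hηD := mul_nonneg hη.le hD
  have hηD' := mul_nonneg hη.le hD'
  have hηE := mul_le_mul_of_nonneg_left h₃ hη.le
  have hητ0 := mul_pos hη hτ
  have hw : 8 * (C * H) / δ ≤ 1 / 2000 := by
    rw [div_le_iff₀ hδ0]
    nlinarith
  have hH' : H ≤ 1 / 16000 := by nlinarith
  have f1 : 8 * (C * H) / δ * (2 * (a + b) + 4 * (η * D + η * D'))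
      ≤ 1 / 2000 * (2 * (a + b) + 4 * (η * D + η * D')) :=
    mul_le_mul_of_nonneg_right hw (by linarith)
  have f2 : H * (2 * b + 8 * (η * D + η * D')) ≤ 1 / 16000 * (2 * b + 8 * (η * D + η * D')) :=
    mul_le_mul_of_nonneg_right hH' (by linarith)
  have hβ1 : δ * (η * τ) / 4 ≤ η * τ := by nlinarith
  have f3 := mul_le_mul_of_nonneg_right hβ1 hK
  have hβ2 : (7 : ℝ) / 8 ≤ 1 - δ * (η * τ) / 4 := by nlinarith
  have f4 := mul_le_mul_of_nonneg_right hβ2 (by linarith : 0 ≤ η * D + 1 / 4 * b)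
  linarith

/-! ### The Lyapunov function and its contraction -/

namespace MarkovGame

theorem klPolicy_nonneg {S A B : Type*} [Fintype S] [Fintype A] [Fintype B] {ρ : S → ℝ}
    (hρ : ρ ∈ stdSimplex ℝ S) {ζ ζ' : (S → A → ℝ) × (S → B → ℝ)}
    (h₁ : IsPolicy ζ.1) (h₂ : IsPolicy ζ.2) (h₁' : IsPolicy ζ'.1) (h₂' : IsPolicy ζ'.2)
    (hp₁ : ∀ s a, 0 < ζ'.1 s a) (hp₂ : ∀ s b, 0 < ζ'.2 s b) : 0 ≤ klPolicy ρ ζ ζ' :=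
  expect_nonneg hρ fun s =>
    add_nonneg (klVec_nonneg (h₁ s) (h₁' s) (hp₁ s)) (klVec_nonneg (h₂ s) (h₂' s) (hp₂ s))

section Convergence

variable {S A B : Type*} [Fintype S] [DecidableEq S] [Fintype A] [Fintype B]

/-- The Lyapunov function of entropy-regularized OMWU. -/
noncomputable def lyapunov (G : MarkovGame S A B) (ρ : S → ℝ) (τ η : ℝ)
    (ζ : (S → A → ℝ) × (S → B → ℝ)) (z : OMWUState S A B) : ℝ :=
  klPolicy ρ ζ z.zeta + 8 / (τ * (1 - G.γ)) * G.reachSup ρ (G.valuePotential τ ζ z)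
    + η * expect ρ (G.qGap τ ζ z) + 1 / 4 * klPolicy ρ z.zeta z.zetaBar

variable {G : MarkovGame S A B} {ρ : S → ℝ} {τ η : ℝ} {ζ : (S → A → ℝ) × (S → B → ℝ)}
  {z : OMWUState S A B}

theorem qGap_nonneg (G : MarkovGame S A B) (τ : ℝ) (ζ : (S → A → ℝ) × (S → B → ℝ))
    (z : OMWUState S A B) (s : S) : 0 ≤ G.qGap τ ζ z s :=
  maxEntry_nonneg _

variable [Nonempty A] [Nonempty B]

theorem reachSup_valuePotential_nonneg {k : ℝ} (hρ : ρ ∈ stdSimplex ℝ S) (hτ : 0 ≤ τ)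
    (hζ : G.IsQRE τ ζ) (hz : z.IsBounded k) : 0 ≤ G.reachSup ρ (G.valuePotential τ ζ z) :=
  (expect_nonneg hρ fun s =>
    (abs_nonneg _).trans (abs_sub_value_le_valuePotential hτ hζ hz s)).trans
    (sum_le_reachSup hρ _)

theorem lyapunov_omwuStep_le (hρ : ρ ∈ stdSimplex ℝ S) (hpos : ∀ s, 0 < ρ s) (hτ : 0 < τ)
    (hη : 0 < η) (hητ : η * τ ≤ 1 / 2) {k : ℝ} (hk : 0 ≤ k)
    (hCk : G.concentrability ρ * (η * k) ≤ (1 - G.γ) ^ 2 / 16000) (hζ : G.IsQRE τ ζ)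
    (hz : z.IsBounded k) (hz' : (G.omwuStep τ η (η * τ) z).IsBounded k) :
    G.lyapunov ρ τ η ζ (G.omwuStep τ η (η * τ) z)
        + 1 / 4 * klPolicy ρ (G.omwuStep τ η (η * τ) z).zetaBar z.zeta
      ≤ (1 - (1 - G.γ) * η * τ / 4) * G.lyapunov ρ τ η ζ z := by
  have hδ0 : 0 < 1 - G.γ := sub_pos.2 G.γ_lt_one
  have hδ1 : 1 - G.γ ≤ 1 := by linarith [G.γ_nonneg]
  have hC := one_le_concentrability (G := G) hρ hpos
  have hH : 0 ≤ η * k := mul_nonneg hη.le hk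
  have hkη : η * k ≤ 1 / 16 := by nlinarith
  have hc : 1 / 2 ≤ 1 - η * τ := by linarith
  set z' := G.omwuStep τ η (η * τ) z with hz'_def
  have ha : ∀ s, 0 ≤ klAt z'.zetaBar z.zeta s := fun s =>
    add_nonneg (klVec_nonneg (hz'.muBar_mem s) (hz.mu_mem s) (hz.mu_pos s))
      (klVec_nonneg (hz'.nuBar_mem s) (hz.nu_mem s) (hz.nu_pos s))
  have hb : ∀ s, 0 ≤ klAt z.zeta z.zetaBar s := fun s =>
    add_nonneg (klVec_nonneg (hz.mu_mem s) (hz.muBar_mem s) (hz.muBar_pos s))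
      (klVec_nonneg (hz.nu_mem s) (hz.nuBar_mem s) (hz.nuBar_pos s))
  have hd := qGap_nonneg G τ ζ z
  have hd' := qGap_nonneg G τ ζ z'
  have s1 := expect_mono hρ (klAt_omwuStep_le hη hk hkη hc hζ hz hz')
  simp only [expect_add, expect_const_mul] at s1
  have s3 := reachSup_le_mul_of_forall_exists hρ
    (exists_qGap_omwuStep_le hτ.le (η := η) (η * τ) hζ hz)
  have s2 := reachSup_le_combo (G := G) hρ (by linarith) (mul_pos hη hτ).le hτ.le
    (valuePotential_omwuStep_le hτ.le hη hk hkη (by linarith) hζ hz hz')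
  -- The only place where the change of distribution costs a factor: it hits just the error terms,
  -- which carry η.
  have s4 := reachSup_le_concentrability_mul (G := G) hρ hpos
    (g := fun s => 2 * (η * k) * (klAt z'.zetaBar z.zeta s + klAt z.zeta z.zetaBar s)
      + 4 * (η * k) * η * (G.qGap τ ζ z s + G.qGap τ ζ z' s))
    (fun s => add_nonneg (mul_nonneg (by linarith) (add_nonneg (ha s) (hb s)))
      (mul_nonneg (mul_nonneg (by linarith) hη.le) (add_nonneg (hd s) (hd' s))))
  change _ ≤ _ * expect ρ _ at s4
  simp only [expect_add, expect_const_mul] at s4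
  have hE := reachSup_valuePotential_nonneg hρ hτ.le hζ hz
  have s5 : expect ρ (G.qGap τ ζ z') ≤ G.reachSup ρ (G.valuePotential τ ζ z) := by
    refine ((sum_le_reachSup hρ _).trans s3).trans ?_
    nlinarith [G.γ_lt_one]
  refine (le_of_eq ?_).trans (coupled_recursion_le
    (K' := klPolicy ρ ζ z'.zeta) (E' := G.reachSup ρ (G.valuePotential τ ζ z'))
    (D' := expect ρ (G.qGap τ ζ z')) (b' := klPolicy ρ z'.zeta z'.zetaBar)
    (a := klPolicy ρ z'.zetaBar z.zeta)
    hδ0 hδ1 hη hτ hητ hH hC hCk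
    (expect_nonneg hρ fun s =>
      add_nonneg (klVec_nonneg (hζ.1 s) (hz.mu_mem s) (hz.mu_pos s))
        (klVec_nonneg (hζ.2.1 s) (hz.nu_mem s) (hz.nu_pos s)))
    (expect_nonneg hρ hd) (expect_nonneg hρ hd') (expect_nonneg hρ ha) (expect_nonneg hρ hb)
    s1 ?_ s5)
  · rw [lyapunov]
  · refine s2.trans (add_le_add (add_le_add le_rfl ?_) (mul_le_mul_of_nonneg_left s4 hτ.le))
    rw [sub_sub_cancel]
    exact mul_le_mul_of_nonneg_left s3 (mul_pos hη hτ).le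

theorem klPolicy_zetaBar_omwuStep_le (hρ : ρ ∈ stdSimplex ℝ S) (hη : 0 < η) {k α : ℝ}
    (hk : 0 ≤ k) (hkη : η * k ≤ 1 / 16) (hζ : G.IsQRE τ ζ) (hz : z.IsBounded k)
    (hz' : (G.omwuStep τ η α z).IsBounded k) :
    1 / 4 * klPolicy ρ ζ (G.omwuStep τ η α z).zetaBar
      ≤ klPolicy ρ ζ (G.omwuStep τ η α z).zeta
        + 2 * (η * k) * (klPolicy ρ (G.omwuStep τ η α z).zetaBar z.zeta
          + klPolicy ρ z.zeta z.zetaBar)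
        + 8 * (η * k) * η
          * (expect ρ (G.qGap τ ζ z) + expect ρ (G.qGap τ ζ (G.omwuStep τ η α z))) := by
  have h := expect_mono hρ (klAt_zetaBar_omwuStep_le hη hk hkη hζ hz hz')
  simp only [expect_add, expect_const_mul] at h
  exact h

/-- Against the uniform policy, τ times either KL divergence is at most 1, and all values are at
most 2/δ. The four terms contribute 2, 40, 2 and 0 in units of 1 / (δ²τ), where 40 = 8 · 5. -/
theorem lyapunov_omwuInit_le (hρ : ρ ∈ stdSimplex ℝ S) (hτ : 0 < τ) (hτ1 : τ ≤ 1)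
    (hτL : τ * (Real.log (Fintype.card A) + Real.log (Fintype.card B)) ≤ 1)
    (hη : 0 < η) (hη1 : η ≤ 1) (hζ : G.IsQRE τ ζ) :
    klPolicy ρ ζ (omwuInit S A B τ).zetaBar ≤ 100 / ((1 - G.γ) ^ 2 * τ) ∧
      G.lyapunov ρ τ η ζ (omwuInit S A B τ) ≤ 100 / ((1 - G.γ) ^ 2 * τ) := by
  have hδ0 : 0 < 1 - G.γ := sub_pos.2 G.γ_lt_one
  have hδ1 : 1 - G.γ ≤ 1 := by linarith [G.γ_nonneg]
  set δ := 1 - G.γ with hδ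
  have hk : 1 ≤ 2 / δ := by
    rw [le_div_iff₀ hδ0]
    linarith
  have hz := isBounded_omwuInit (S := S) (A := A) (B := B) hτ.le hτL hk
  have hV := fun s => abs_le.1 (abs_value_le (G := G) hτ.le hτL hζ.1 hζ.2.1 s)
  have hkl₁ : ∀ s, τ * klVec (ζ.1 s) ((omwuInit S A B τ).mu s) ≤ 1 := fun s => by
    change τ * klVec (ζ.1 s) (fun _ => 1 / (Fintype.card A : ℝ)) ≤ 1
    rw [klVec_uniform (hζ.1 s)]
    have := mul_nonneg hτ.le (entropy_nonneg (hζ.1 s))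
    have := mul_nonneg hτ.le (log_card_nonneg B)
    linarith
  have hkl₂ : ∀ s, τ * klVec (ζ.2 s) ((omwuInit S A B τ).nu s) ≤ 1 := fun s => by
    change τ * klVec (ζ.2 s) (fun _ => 1 / (Fintype.card B : ℝ)) ≤ 1
    rw [klVec_uniform (hζ.2.1 s)]
    have := mul_nonneg hτ.le (entropy_nonneg (hζ.2.1 s))
    have := mul_nonneg hτ.le (log_card_nonneg A)
    linarith
  have h1 : klPolicy ρ ζ (omwuInit S A B τ).zeta ≤ 2 / τ := by
    refine expect_le_of_forall_le hρ (g := klAt ζ (omwuInit S A B τ).zeta) fun s => ?_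
    rw [le_div_iff₀ hτ]
    have := hkl₁ s
    have := hkl₂ s
    simp only [klAt, OMWUState.zeta]
    linarith
  have h2 : G.reachSup ρ (G.valuePotential τ ζ (omwuInit S A B τ)) ≤ 5 / δ := by
    refine reachSup_le_of_forall_le hρ fun s => ?_
    have h3 := abs_le.1 (hz.abs_V_le s)
    have h4 : 5 / δ = 2 / δ + 2 / δ + 1 / δ := by ring
    have h5 : 1 ≤ 1 / δ := one_le_one_div hδ0 hδ1
    rw [h4]
    exact max_le (by linarith [(hV s).1, (hV s).2, hkl₂ s])
      (by linarith [(hV s).1, (hV s).2, hkl₁ s])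
  have hQ : ∀ s a b, |G.qValue τ ζ.1 ζ.2 s a b| ≤ 2 / δ := fun s a b => by
    refine (G.abs_lookahead_le (fun s => abs_le.2 (hV s)) s a b).trans ?_
    have e : 1 + G.γ * (2 / δ) + 1 = 2 / δ := by
      have hγ : G.γ = 1 - δ := by rw [hδ]; ring
      rw [hγ]
      field_simp
      ring
    linarith
  have h3 : expect ρ (G.qGap τ ζ (omwuInit S A B τ)) ≤ 2 / δ := by
    refine expect_le_of_forall_le hρ fun s => ?_
    obtain ⟨a, b, hab⟩ := exists_maxEntry_eq
      fun a b => (omwuInit S A B τ).Q s a b - G.qValue τ ζ.1 ζ.2 s a b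
    rw [qGap, hab]
    simpa [omwuInit] using hQ s a b
  have h4 : klPolicy ρ (omwuInit S A B τ).zeta (omwuInit S A B τ).zetaBar = 0 := by
    simp [klPolicy, omwuInit, OMWUState.zeta, OMWUState.zetaBar, klVec_self]
  have hδ2 : δ ^ 2 ≤ 1 := pow_le_one₀ hδ0.le hδ1
  have b1 : 2 / τ ≤ 2 / (δ ^ 2 * τ) := by
    refine div_le_div_of_nonneg_left (by norm_num) (by positivity) ?_
    nlinarith
  have b2 : 2 / δ ≤ 2 / (δ ^ 2 * τ) := by
    refine div_le_div_of_nonneg_left (by norm_num) (by positivity) ?_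
    have : δ * τ ≤ 1 := by nlinarith
    nlinarith
  have b3 : 8 / (τ * δ) * G.reachSup ρ (G.valuePotential τ ζ (omwuInit S A B τ))
      ≤ 40 / (δ ^ 2 * τ) := by
    refine (mul_le_mul_of_nonneg_left h2 (by positivity)).trans_eq ?_
    field_simp
    norm_num
  have b4 : η * expect ρ (G.qGap τ ζ (omwuInit S A B τ)) ≤ 2 / δ := by
    have := expect_nonneg hρ (qGap_nonneg G τ ζ (omwuInit S A B τ))
    nlinarith
  have b5 : 100 / (δ ^ 2 * τ) = 40 / (δ ^ 2 * τ) + 2 / (δ ^ 2 * τ) + 2 / (δ ^ 2 * τ)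
      + 56 / (δ ^ 2 * τ) := by ring
  have b6 : 0 < 56 / (δ ^ 2 * τ) := by positivity
  have b7 : 0 < 40 / (δ ^ 2 * τ) := by positivity
  have b8 : 0 < 2 / (δ ^ 2 * τ) := by positivity
  constructor
  · change klPolicy ρ ζ (omwuInit S A B τ).zeta ≤ _
    linarith
  · rw [lyapunov, h4, ← hδ]
    linarith

end Convergence

end MarkovGame

/-! ### Assembly of the convergence theorem -/

theorem theorem3 {S A B : Type*} [Fintype S] [DecidableEq S] [Fintype A] [Nonempty A]
    [Fintype B] [Nonempty B] (G : MarkovGame S A B)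
    (ρ : S → ℝ) (hρ : ρ ∈ stdSimplex ℝ S) (hρ_pos : ∀ s, 0 < ρ s)
    (τ : ℝ) (hτ_pos : 0 < τ)
    (hτ : τ ≤ 1 / max 1 (Real.log (Fintype.card A) + Real.log (Fintype.card B)))
    (η : ℝ) (hη_pos : 0 < η) (hη : η ≤ (1 - G.γ) ^ 3 / (32000 * G.concentrability ρ))
    (α : ℕ → ℝ) (hα : ∀ i, 1 ≤ i → α i = η * τ) :
    (∃! ζ : (S → A → ℝ) × (S → B → ℝ), G.IsQRE τ ζ) ∧
    ∀ ζ : (S → A → ℝ) × (S → B → ℝ), G.IsQRE τ ζ → ∀ t : ℕ,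
      max (klPolicy ρ ζ (G.omwu τ η α t).zeta)
        (max (1 / 2 * klPolicy ρ ζ (G.omwu τ η α t).zetaBar)
          (3 * η * ∑ s, ρ s *
            maxEntry (fun a b => (G.omwu τ η α t).Q s a b - G.qValue τ ζ.1 ζ.2 s a b)))
      ≤ 3000 / ((1 - G.γ) ^ 2 * τ) * (1 - (1 - G.γ) * η * τ / 4) ^ t := by
  obtain ⟨ζ₀, hζ₀⟩ := MarkovGame.exists_isQRE (G := G) hτ_pos
  refine ⟨⟨ζ₀, hζ₀, fun ζ hζ => hζ.unique hτ_pos hζ₀⟩, fun ζ hζ t => ?_⟩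
  have hδ0 : 0 < 1 - G.γ := sub_pos.2 G.γ_lt_one
  have hδ1 : 1 - G.γ ≤ 1 := by linarith [G.γ_nonneg]
  have hC := MarkovGame.one_le_concentrability (G := G) hρ hρ_pos
  have hm0 : (0 : ℝ) < max 1 (Real.log (Fintype.card A) + Real.log (Fintype.card B)) :=
    lt_max_of_lt_left one_pos
  rw [le_div_iff₀ hm0] at hτ
  have hτ1 : τ ≤ 1 :=
    (le_mul_of_one_le_right hτ_pos.le (le_max_left _ _)).trans hτ
  have hτL : τ * (Real.log (Fintype.card A) + Real.log (Fintype.card B)) ≤ 1 :=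
    (mul_le_mul_of_nonneg_left (le_max_right _ _) hτ_pos.le).trans hτ
  rw [le_div_iff₀ (by positivity)] at hη
  have hk : 0 ≤ 2 / (1 - G.γ) := by positivity
  have hfix : 1 + G.γ * (2 / (1 - G.γ)) + 1 = 2 / (1 - G.γ) := by
    field_simp
    ring
  -- The value bound 2 / (1 - γ) uses up one power of 1 - γ and a factor 2 from the step-size
  -- condition.
  have hCk : G.concentrability ρ * (η * (2 / (1 - G.γ))) ≤ (1 - G.γ) ^ 2 / 16000 := by
    rw [show G.concentrability ρ * (η * (2 / (1 - G.γ)))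
      = 2 * (η * G.concentrability ρ) / (1 - G.γ) by ring, div_le_iff₀ hδ0]
    linarith
  have hη1 : η ≤ 1 / 32000 := by
    have : (1 - G.γ) ^ 3 ≤ 1 := pow_le_one₀ hδ0.le hδ1
    nlinarith
  have hητ : η * τ ≤ 1 / 2 := by nlinarith
  have hητ0 := mul_pos hη_pos hτ_pos
  have hH : 0 ≤ η * (2 / (1 - G.γ)) := mul_nonneg hη_pos.le hk
  have hkη : η * (2 / (1 - G.γ)) ≤ 1 / 16 := by nlinarith
  have hstep : ∀ t, G.omwu τ η α (t + 1) = G.omwuStep τ η (η * τ) (G.omwu τ η α t) := fun t => by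
    rw [MarkovGame.omwu, hα (t + 1) (by omega)]
  have hz : ∀ t, (G.omwu τ η α t).IsBounded (2 / (1 - G.γ)) := fun t => by
    induction t with
    | zero =>
      refine MarkovGame.isBounded_omwuInit hτ_pos.le hτL ?_
      rw [le_div_iff₀ hδ0]
      linarith
    | succ t ih =>
      rw [hstep]
      exact MarkovGame.isBounded_omwuStep hτ_pos.le hτL hfix.le hητ0.le (by linarith) ih
  set k := 2 / (1 - G.γ)
  set β := 1 - (1 - G.γ) * η * τ / 4 with hβ
  have hβ0 : 0 ≤ β := by
    have : (1 - G.γ) * (η * τ) ≤ 1 := by nlinarith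
    rw [hβ]
    linarith
  have hK : ∀ t, 0 ≤ klPolicy ρ ζ (G.omwu τ η α t).zeta := fun t =>
    MarkovGame.klPolicy_nonneg hρ hζ.1 hζ.2.1 (hz t).mu_mem (hz t).nu_mem (hz t).mu_pos (hz t).nu_pos
  have hb : ∀ t, 0 ≤ klPolicy ρ (G.omwu τ η α t).zeta (G.omwu τ η α t).zetaBar := fun t =>
    MarkovGame.klPolicy_nonneg hρ (hz t).mu_mem (hz t).nu_mem (hz t).muBar_mem (hz t).nuBar_mem
      (hz t).muBar_pos (hz t).nuBar_pos
  have ha : ∀ t, 0 ≤ klPolicy ρ (G.omwu τ η α (t + 1)).zetaBar (G.omwu τ η α t).zeta := fun t =>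
    MarkovGame.klPolicy_nonneg hρ (hz _).muBar_mem (hz _).nuBar_mem (hz t).mu_mem (hz t).nu_mem
      (hz t).mu_pos (hz t).nu_pos
  have hD : ∀ t, 0 ≤ η * expect ρ (G.qGap τ ζ (G.omwu τ η α t)) := fun t =>
    mul_nonneg hη_pos.le (expect_nonneg hρ (MarkovGame.qGap_nonneg G τ ζ _))
  have hE : ∀ t, 0 ≤ 8 / (τ * (1 - G.γ))
      * G.reachSup ρ (G.valuePotential τ ζ (G.omwu τ η α t)) := fun t =>
    mul_nonneg (by positivity)
      (MarkovGame.reachSup_valuePotential_nonneg hρ hτ_pos.le hζ (hz t))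
  have hlyap : ∀ t, G.lyapunov ρ τ η ζ (G.omwu τ η α (t + 1))
      + 1 / 4 * klPolicy ρ (G.omwu τ η α (t + 1)).zetaBar (G.omwu τ η α t).zeta
      ≤ β * G.lyapunov ρ τ η ζ (G.omwu τ η α t) := fun t => by
    have h := hz (t + 1)
    rw [hstep] at h ⊢
    exact MarkovGame.lyapunov_omwuStep_le hρ hρ_pos hτ_pos hη_pos hητ hk hCk hζ (hz t) h
  obtain ⟨hbar0, hinit⟩ := MarkovGame.lyapunov_omwuInit_le (G := G) hρ hτ_pos hτ1 hτL hη_pos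
    (hη1.trans (by norm_num)) hζ
  have hgeo : ∀ t, G.lyapunov ρ τ η ζ (G.omwu τ η α t)
      ≤ 100 / ((1 - G.γ) ^ 2 * τ) * β ^ t := fun t => by
    induction t with
    | zero => rwa [pow_zero, mul_one]
    | succ t ih =>
      have h1 := hlyap t
      have h2 := mul_le_mul_of_nonneg_left ih hβ0
      have h3 := ha t
      rw [pow_succ β t]
      linarith
  -- The Lyapunov function does not contain the divergence to ζ̄, so it is recovered from one step.
  -- The terms of indices t and t + 1 each cost at most one copy of the bound, and dividing by 1/4
  -- gives 8.
  have hbar : ∀ t, klPolicy ρ ζ (G.omwu τ η α t).zetaBar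
      ≤ 8 * (100 / ((1 - G.γ) ^ 2 * τ) * β ^ t) := fun t => by
    cases t with
    | zero =>
      rw [pow_zero, mul_one]
      have : 0 ≤ 100 / ((1 - G.γ) ^ 2 * τ) := by positivity
      exact hbar0.trans (by linarith)
    | succ t =>
      have h1 : 1 / 4 * klPolicy ρ ζ (G.omwu τ η α (t + 1)).zetaBar
          ≤ klPolicy ρ ζ (G.omwu τ η α (t + 1)).zeta
            + 2 * (η * k) * (klPolicy ρ (G.omwu τ η α (t + 1)).zetaBar (G.omwu τ η α t).zeta
              + klPolicy ρ (G.omwu τ η α t).zeta (G.omwu τ η α t).zetaBar)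
            + 8 * (η * k) * η * (expect ρ (G.qGap τ ζ (G.omwu τ η α t))
              + expect ρ (G.qGap τ ζ (G.omwu τ η α (t + 1)))) := by
        have h := hz (t + 1)
        rw [hstep] at h ⊢
        exact MarkovGame.klPolicy_zetaBar_omwuStep_le hρ hη_pos hk hkη hζ (hz t) h
      have hη' : η * k ≤ 1 / 64 := by nlinarith
      have h2 := mul_le_mul_of_nonneg_right hη' (add_nonneg (ha t) (hb t))
      have h3 := mul_le_mul_of_nonneg_right hη' (add_nonneg (hD t) (hD (t + 1)))
      have h4 := hlyap t
      have h5 := mul_le_mul_of_nonneg_left (hgeo t) hβ0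
      -- Since β is close to 1, the quantities of index t are also controlled by the bound with
      -- exponent t + 1.
      have h6 : 7 / 8 * G.lyapunov ρ τ η ζ (G.omwu τ η α t)
          ≤ β * G.lyapunov ρ τ η ζ (G.omwu τ η α t) := by
        refine mul_le_mul_of_nonneg_right ?_ ?_
        · have : (1 - G.γ) * (η * τ) ≤ 1 / 2 := by nlinarith
          rw [hβ]
          linarith
        · rw [MarkovGame.lyapunov]
          linarith [hK t, hb t, hD t, hE t]
      have h7 := hE t
      have h8 := hE (t + 1)
      have h9 := ha t
      have h10 := hb (t + 1)
      have h11 := hK t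
      rw [pow_succ β t]
      simp only [MarkovGame.lyapunov] at h4 h5 h6
      linarith [hb t, hD t, hD (t + 1)]
  have hR : 0 ≤ 100 / ((1 - G.γ) ^ 2 * τ) * β ^ t := mul_nonneg (by positivity) (pow_nonneg hβ0 t)
  have hR' : 3000 / ((1 - G.γ) ^ 2 * τ) * β ^ t
      = 30 * (100 / ((1 - G.γ) ^ 2 * τ) * β ^ t) := by ring
  have hg := hgeo t
  rw [MarkovGame.lyapunov] at hg
  rw [hR']
  refine max_le ?_ (max_le ?_ ?_)
  · linarith [hb t, hD t, hE t]
  · linarith [hbar t]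
  · change 3 * η * expect ρ (G.qGap τ ζ (G.omwu τ η α t)) ≤ _
    linarith [hK t, hb t, hD t, hE t]
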